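/- Setting. Let $G=(V,E)$ be a finite connected simple graph and let $\beta,\gamma,\lambda\in\mathbb R$ with $0\le\beta\le\gamma$, $\gamma>0$, $\lambda>0$. The Gibbs distribution $\mu$ on $\{\pm1\}^V$ specified by $(\beta,\gamma,\lambda)$ gives $\sigma$ probability proportional to $\lambda^{\#\{v:\sigma(v)=1\}}\,\beta^{\#\{\text{edges with both ends }1\}}\,\gamma^{\#\{\text{edges with both ends }-1\}}$ (with $0^0=1$). It is $b$-marginally bounded if for every $\Lambda\subseteq V$, every $\tau\in\{\pm1\}^\Lambda$ of positive probability, every $u\in V\setminus\Lambda$ and every $x\in\{\pm1\}$ in the support of $\mu_u(\cdot\mid\Lambda,\tau)$, one has $\mu_u(x\mid\Lambda,\tau)\ge b$. The influence matrix $\mathcal I^{\Lambda,\tau}_G$ is the $(V\setminus\Lambda)\times(V\setminus\Lambda)$ matrix with entries $$\mathcal I^{\Lambda,\tau}_G(w,u)=\mu_u(+1\mid(\Lambda,\tau),(w,+1))-\mu_u(+1\mid(\Lambda,\tau),(w,-1)),$$ where the entry is $0$ if $\mu_w(+1\mid\Lambda,\tau)\in\{0,1\}$ or $\mu_u(+1\mid\Lambda,\tau)\in\{0,1\}$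 (and the matrix is $0$ if $\tau$ has probability $0$). For $k\ge1$, the $k$-non-backtracking matrix $H_{G,k}$ is indexed by the self-avoiding walks of length $k$ in $G$, and its entry at $P=x_0,\dots,x_k$ and $Q=z_0,\dots,z_k$ is $1$ if $x_0\ne z_k$ and $z_i=x_{i+1}$ for all $0\le i<k$, and $0$ otherwise. $\|\cdot\|_2$ is the operator norm induced by the Euclidean norm, and $\varrho(\cdot)$ (not to be confused with the number $\rho$ below) is the spectral radius. Potentials. Let $$H_d(y_1,\dots,y_d)=\log\lambda+\sum_{i=1}^d\log\frac{\beta e^{y_i}+1}{e^{y_i}+\gamma},\qquad h(y)=-\frac{(1-\beta\gamma)e^{y}}{(\beta e^{y}+1)(e^{y}+\gamma)}.$$ Let $J_d$ be the set of all $x\in\mathbb R$ such that $e^x$ lies in the closed interval with endpoints $\lambda\beta^d$ and $\lambda/\gamma^d$, and let $J=\bigcup_{1\le d<\Delta}J_d$. For $s\ge1$ and $\delta,c>0$, an $(s,\delta,c)$-potential with respect to $(\beta,\gamma,\lambda)$ (and $\Delta$) is a differentiable, strictly increasing function $\Psi:\mathbb R\to\mathbb R$ with $\chi=\Psi'>0$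 such that: (Contraction) for all $1\le d<\Delta$, $y\in\mathbb R^d$ and $m\in\mathbb R^d_{\ge0}$, $$\chi(H_d(y_1,\dots,y_d))\sum_{j=1}^d\frac{|h(y_j)|}{\chi(y_j)}\,m_j\le\delta^{1/s}\Big(\sum_{j=1}^d m_j^s\Big)^{1/s};$$ (Boundedness) $\chi(z)\,|h(x)|/\chi(x)\le c$ for all $z,x\in J$. Theorem. Let $b\in(0,1)$, $\rho>1$, $c>0$ and let $k,N\ge1$, $\Delta>1$ be integers. There is a number $C>1$, depending only on $b,\rho,c,k,N,\Delta$, such that the following holds. Let $\varepsilon\in(0,1)$, $s\ge1$, and let $\beta,\gamma,\lambda\in\mathbb R$ with $0\le\beta\le\gamma$, $\gamma>0$, $\lambda>0$. Suppose that for $\delta=\frac{1-\varepsilon}{\rho}$ there is an $(s,\delta,c)$-potential with respect to $(\beta,\gamma,\lambda)$. Let $G=(V,E)$ be a finite connected graph of maximum degree $\Delta$ such that $\|(H_{G,k})^N\|_2^{1/N}=\rho$ and such that the Gibbs distribution $\mu$ on $G$ specified by $(\beta,\gamma,\lambda)$ is $b$-marginally bounded. Then for every $\Lambda\subseteq V$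 and every $\tau\in\{\pm1\}^\Lambda$, $$\varrho\big(\mathcal I^{\Lambda,\tau}_G\big)\le\frac{C}{1-(1-\varepsilon/4)^{1/s}}.$$ -/

import Mathlib

/-! ## Two-spin Gibbs distributions and their influence matrices -/

namespace TwoSpin

noncomputable section

/-- Configurations in `{±1}^V`; the two spins are the units `1` and `-1` of `ℤ`. -/
abbrev Config (V : Type*) := V → ℤˣ

section Gibbs

variable {V : Type*} [Fintype V] [DecidableEq V]

/-- The weight `lam ^ #{v | σ v = 1} * β ^ #{edges with both ends 1} * γ ^ #{edges with both
ends -1}` of a configuration. -/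
def weight (G : SimpleGraph V) [DecidableRel G.Adj] (β γ lam : ℝ) (σ : Config V) : ℝ :=
  lam ^ (Finset.univ.filter fun v => σ v = 1).card
    * β ^ (G.edgeFinset.filter fun e => ∀ v ∈ e, σ v = 1).card
    * γ ^ (G.edgeFinset.filter fun e => ∀ v ∈ e, σ v = -1).card

/-- The partition function. -/
def partitionFunction (G : SimpleGraph V) [DecidableRel G.Adj] (β γ lam : ℝ) : ℝ :=
  ∑ σ : Config V, weight G β γ lam σ

/-- The probability mass function of the Gibbs distribution. -/
def gibbs (G : SimpleGraph V) [DecidableRel G.Adj] (β γ lam : ℝ) (σ : Config V) : ℝ :=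
  weight G β γ lam σ / partitionFunction G β γ lam

/-- The probability of an event under a probability mass function. -/
def prob (μ : Config V → ℝ) (A : Set (Config V)) : ℝ :=
  ∑ σ : Config V, A.indicator μ σ

/-- The conditional probability of `A` given `B`; it is `0` when `B` has probability `0`. -/
def condProb (μ : Config V → ℝ) (A B : Set (Config V)) : ℝ :=
  prob μ (A ∩ B) / prob μ B

/-- The event that the configuration at `Λ` is `τ`. -/
def pinned (Λ : Finset V) (τ : Λ → ℤˣ) : Set (Config V) :=
  {σ | ∀ v : Λ, σ v = τ v}

/-- The event that vertex `v` has spin `x`. -/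
def hasSpin (v : V) (x : ℤˣ) : Set (Config V) :=
  {σ | σ v = x}

/-- The conditional marginal `μ_u(x | Λ, τ)`. -/
def marginal (μ : Config V → ℝ) (Λ : Finset V) (τ : Λ → ℤˣ) (u : V) (x : ℤˣ) : ℝ :=
  condProb μ (hasSpin u x) (pinned Λ τ)

/-- `b`-marginal boundedness: under every pinning, each spin in the support of the marginal of an
unpinned vertex has probability at least `b`.  (A pinning of probability `0` has all its marginals
equal to `0`, so that it imposes no condition.) -/
def IsMarginallyBounded (b : ℝ) (μ : Config V → ℝ) : Prop :=
  ∀ (Λ : Finset V) (τ : Λ → ℤˣ) (u : V), u ∉ Λ → ∀ x : ℤˣ,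
    0 < marginal μ Λ τ u x → b ≤ marginal μ Λ τ u x

open Classical in
/-- The pairwise influence matrix, indexed by the unpinned vertices, with entries
`μ_u(+1 | (Λ, τ), (w, +1)) - μ_u(+1 | (Λ, τ), (w, -1))`; by convention the entry is `0` when the
marginal of `w` or of `u` under the pinning is deterministic. -/
def influenceMatrix (μ : Config V → ℝ) (Λ : Finset V) (τ : Λ → ℤˣ) :
    Matrix {v : V // v ∉ Λ} {v : V // v ∉ Λ} ℝ :=
  Matrix.of fun w u =>
    if marginal μ Λ τ w 1 ∈ ({0, 1} : Set ℝ) ∨ marginal μ Λ τ u 1 ∈ ({0, 1} : Set ℝ) then 0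
    else condProb μ (hasSpin (u : V) 1) (pinned Λ τ ∩ hasSpin (w : V) 1)
      - condProb μ (hasSpin (u : V) 1) (pinned Λ τ ∩ hasSpin (w : V) (-1))

end Gibbs

/-! ## The `k`-non-backtracking matrix -/

section NonBacktracking

variable {V : Type*}

/-- Self-avoiding walks `x 0, …, x k` of length `k` in `G`. -/
def SAWalk (G : SimpleGraph V) (k : ℕ) :=
  {x : Fin (k + 1) → V // Function.Injective x ∧ ∀ i : Fin k, G.Adj (x i.castSucc) (x i.succ)}

instance (G : SimpleGraph V) (k : ℕ) [Fintype V] : Fintype (SAWalk G k) := by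
  classical
  unfold SAWalk
  infer_instance

instance (G : SimpleGraph V) (k : ℕ) : DecidableEq (SAWalk G k) :=
  Classical.decEq _

open Classical in
/-- The `k`-non-backtracking matrix: the entry at `P = x 0, …, x k` and `Q = z 0, …, z k` is `1` if
`x 0 ≠ z k` and `z i = x (i + 1)` for all `0 ≤ i < k`, and `0` otherwise. -/
def nonBacktrackingMatrix (G : SimpleGraph V) (k : ℕ) : Matrix (SAWalk G k) (SAWalk G k) ℝ :=
  Matrix.of fun P Q =>
    if P.1 0 ≠ Q.1 (Fin.last k) ∧ ∀ i : Fin k, Q.1 i.castSucc = P.1 i.succ then 1 else 0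

end NonBacktracking

/-- The operator norm of a real square matrix for the Euclidean norm. -/
def l2Norm {ι : Type*} [Fintype ι] [DecidableEq ι] (M : Matrix ι ι ℝ) : ℝ :=
  ‖Matrix.toEuclideanCLM (n := ι) (𝕜 := ℝ) M‖

/-- The spectral radius of a real square matrix: the largest modulus of a complex eigenvalue
(`0` for the empty matrix). -/
def matrixSpectralRadius {ι : Type*} [Fintype ι] [DecidableEq ι] (M : Matrix ι ι ℝ) :
    ENNReal :=
  spectralRadius ℂ (M.map Complex.ofReal)

/-! ## Potential functions -/

/-- The recursion `H_d` for the log-ratios of the marginals at the root of a tree, as a function of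
the log-ratios at its `d` children. -/
def logRecursion (β γ lam : ℝ) {d : ℕ} (y : Fin d → ℝ) : ℝ :=
  Real.log lam + ∑ i, Real.log ((β * Real.exp (y i) + 1) / (Real.exp (y i) + γ))

/-- The partial derivative of `H_d` with respect to any of its coordinates. -/
def logRatioDeriv (β γ x : ℝ) : ℝ :=
  -((1 - β * γ) * Real.exp x) / ((β * Real.exp x + 1) * (Real.exp x + γ))

/-- The interval `J_d` of the log-ratios of a vertex with `d` children: it consists of the reals
whose exponential lies between `lam * β ^ d` and `lam / γ ^ d`.  It is unbounded below when
`β = 0`. -/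
def logRatioInterval (β γ lam : ℝ) (d : ℕ) : Set ℝ :=
  {x | Real.exp x ∈ Set.uIcc (lam * β ^ d) (lam / γ ^ d)}

/-- The union `J` of the intervals `J_d` over `1 ≤ d < Δ`. -/
def logRatioRange (Δ : ℕ) (β γ lam : ℝ) : Set ℝ :=
  ⋃ d ∈ Set.Ico 1 Δ, logRatioInterval β γ lam d

/-- `Ψ` is an `(s, δ, c)`-potential for the functions `H_d`, `1 ≤ d < Δ`, with respect to
`(β, γ, lam)`.  As `Ψ` is injective, the points `y j = Ψ⁻¹ (ŷ j)` with `ŷ j` in the image of `Ψ`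
are arbitrary reals. -/
structure IsPotential (s δ c : ℝ) (Δ : ℕ) (β γ lam : ℝ) (Ψ : ℝ → ℝ) : Prop where
  differentiable : Differentiable ℝ Ψ
  strictMono : StrictMono Ψ
  /-- `Ψ` is strictly increasing in the sense that its derivative, by which the two conditions
  below divide, is positive. -/
  deriv_pos : ∀ x, 0 < deriv Ψ x
  contraction : ∀ d : ℕ, 1 ≤ d → d < Δ → ∀ y m : Fin d → ℝ, (∀ j, 0 ≤ m j) →
    deriv Ψ (logRecursion β γ lam y) * ∑ j, |logRatioDeriv β γ (y j)| / deriv Ψ (y j) * m j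
      ≤ δ ^ (1 / s) * (∑ j, m j ^ s) ^ (1 / s)
  boundedness : ∀ z ∈ logRatioRange Δ β γ lam, ∀ x ∈ logRatioRange Δ β γ lam,
    deriv Ψ z * (|logRatioDeriv β γ x| / deriv Ψ x) ≤ c

end

end TwoSpin

/-!
The influence of `w` on `u` is expanded along self-avoiding walks. To remove a vertex `v` from a
region, give each of its neighbours its own copy of `v`. Conditioning on the spin of `v` fixes all
copies, and switching the copies from `-1` to `1` one at a time writes the influence of `v` as a sum,
over its neighbours, of a derivative of the recursion times the influence of that neighbour in the
smaller region (`mean_sub_mean_attach`, `regionInfluence_eq`). The other copies become external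
fields. This is the recursion of the tree of self-avoiding walks, without the tree: iterated, it
bounds the sum of `|I(w, u)| * m u` over `u` by sums `walkSum` over walks of each length `ℓ`
(`sum_abs_regionInfluence_le`).

Except at the first vertex of a walk, a vertex has at most `Δ - 1` children, counting the copies
already attached to it as pinned children. The contraction property of the potential concerns finite
log-ratios, but it passes to pinned children in the limit, although `χ` need not be continuous: a
derivative bounded on an open interval obeys the same bound at the end points
(`deriv_le_of_forall_mem_Ioo`, `IsPotential.contraction_ratio`). Contraction in the interior of
the walk and boundedness at its ends give (`IsPotential.walkSum_root_le`)
`walkSum m ℓ w ≤ K * (δ ^ (ℓ - 2) * walkCount (m ^ s) ℓ w) ^ (1 / s)`,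
where `walkCount f ℓ w` sums `f` over the ends of the self-avoiding walks of length `ℓ` from `w`.

The windows of `k + 1` consecutive vertices of a self-avoiding walk form a walk of the
`k`-non-backtracking matrix, so that `f ↦ walkCount f ℓ` has `ℓ²`-norm at most a constant times
`ρ ^ ℓ` (`sum_sq_walkCount_le`). Hence the part of length `ℓ` of the influence matrix is bounded on
`ℓ^(2s)` by a constant times `((1 - ε) ^ (ℓ - 2)) ^ (1 / s)`. Summing over `ℓ` bounds the moduli of
the eigenvalues (`matrixSpectralRadius_influenceMatrix_le`), with a rate better than the one claimed.
-/

set_option linter.unusedSectionVars false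

namespace TwoSpin

noncomputable section

/-! ### Telescoping along the neighbours of a vertex -/

section Telescoping

variable {V : Type*} [Fintype V] [DecidableEq V]

/-- The contribution of an edge whose ends have spins `x` and `y` to the weight. -/
def edgeFactor (β γ : ℝ) (x y : ℤˣ) : ℝ :=
  if x = 1 then (if y = 1 then β else 1) else (if y = 1 then 1 else γ)

/-- The total mass of the weight function `F` on configurations. -/
def mass (F : Config V → ℝ) : ℝ := ∑ σ, F σ

/-- The mass of the configurations with spin `x` at `v`. -/
def spinMass (F : Config V → ℝ) (v : V) (x : ℤˣ) : ℝ := ∑ σ, if σ v = x then F σ else 0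

/-- The ratio of the masses of the two spins at `v`. -/
def spinRatio (F : Config V → ℝ) (v : V) : ℝ := spinMass F v 1 / spinMass F v (-1)

/-- The influence of the spin at `v` on the mean of `f`: the difference of the means of `f` given
spin `1` and given spin `-1` at `v`, under the measure with density proportional to `F`. -/
def influence (F f : Config V → ℝ) (v : V) : ℝ :=
  spinMass (F * f) v 1 / spinMass F v 1 - spinMass (F * f) v (-1) / spinMass F v (-1)

/-- The weight `F` after a vertex of spin `ξ a` has been attached by an edge to each `a ∈ N`. -/
def attach (β γ : ℝ) (F : Config V → ℝ) (ξ : V → ℤˣ) (N : Finset V) : Config V → ℝ :=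
  fun σ => F σ * ∏ a ∈ N, edgeFactor β γ (ξ a) (σ a)

/-- The derivative of the tree recursion with respect to the log-ratio of a child, as a function
of the ratio `r` of the child. -/
def edgeInfluence (β γ r : ℝ) : ℝ := (β * γ - 1) * r / ((β * r + 1) * (r + γ))

/-- The spins of the copies of a removed vertex that are attached to its neighbours other than
`u`: copies are `1` before `u` and `-1` after `u`, in a fixed enumeration of the vertices. -/
def copySpin (u a : V) : ℤˣ := if Fintype.equivFin V a < Fintype.equivFin V u then 1 else -1

lemma edgeFactor_comm (β γ : ℝ) (x y : ℤˣ) : edgeFactor β γ x y = edgeFactor β γ y x := by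
  unfold edgeFactor; split_ifs <;> rfl

lemma edgeFactor_nonneg {β γ : ℝ} (hβ : 0 ≤ β) (hγ : 0 < γ) (x y : ℤˣ) :
    0 ≤ edgeFactor β γ x y := by
  unfold edgeFactor; split_ifs <;> positivity

lemma edgeFactor_neg_one_pos {β γ : ℝ} (hγ : 0 < γ) (x : ℤˣ) : 0 < edgeFactor β γ x (-1) := by
  unfold edgeFactor
  have : (-1 : ℤˣ) ≠ 1 := by decide
  simp only [this, if_false]; split_ifs <;> positivity

lemma spinMass_nonneg {F : Config V → ℝ} (hF : 0 ≤ F) (v : V) (x : ℤˣ) : 0 ≤ spinMass F v x :=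
  Finset.sum_nonneg fun σ _ => by split_ifs; exacts [hF σ, le_rfl]

lemma spinMass_neg_one_pos {F : Config V → ℝ} (hF : 0 ≤ F) (hF' : 0 < F (fun _ => -1)) (v : V) :
    0 < spinMass F v (-1) :=
  Finset.sum_pos' (fun σ _ => by split_ifs; exacts [hF σ, le_rfl])
    ⟨fun _ => -1, Finset.mem_univ _, by simpa using hF'⟩

lemma spinRatio_nonneg {F : Config V → ℝ} (hF : 0 ≤ F) (v : V) : 0 ≤ spinRatio F v :=
  div_nonneg (spinMass_nonneg hF _ _) (spinMass_nonneg hF _ _)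

lemma mass_eq_spinMass_add (F : Config V → ℝ) (v : V) :
    mass F = spinMass F v 1 + spinMass F v (-1) := by
  unfold mass spinMass
  rw [← Finset.sum_add_distrib]
  refine Finset.sum_congr rfl fun σ _ => ?_
  rcases Int.units_eq_one_or (σ v) with h | h <;> rw [h] <;> simp

lemma mass_mul_edgeFactor (β γ : ℝ) (F : Config V → ℝ) (v : V) (x : ℤˣ) :
    mass (fun σ => F σ * edgeFactor β γ x (σ v))
      = edgeFactor β γ x 1 * spinMass F v 1 + edgeFactor β γ x (-1) * spinMass F v (-1) := by
  unfold mass spinMass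
  rw [Finset.mul_sum, Finset.mul_sum, ← Finset.sum_add_distrib]
  refine Finset.sum_congr rfl fun σ _ => ?_
  rcases Int.units_eq_one_or (σ v) with h | h <;> simp [h, mul_comm]

lemma spinMass_mul_eq_zero {F : Config V → ℝ} (hF : 0 ≤ F) {v : V} {x : ℤˣ}
    (h : spinMass F v x = 0) (f : Config V → ℝ) : spinMass (F * f) v x = 0 := by
  have h' := (Finset.sum_eq_zero_iff_of_nonneg (fun σ _ => by
    split_ifs; exacts [hF σ, le_rfl])).1 h
  refine Finset.sum_eq_zero fun σ hσ => ?_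
  have := h' σ hσ
  split_ifs with hx
  · rw [if_pos hx] at this; simp [this]
  · rfl

section

variable {β γ : ℝ} (hβ : 0 ≤ β) (hγ : 0 < γ) {F : Config V → ℝ} (hF : 0 ≤ F)
  (hF' : 0 < F (fun _ => -1))

include hβ hγ hF hF'

/-- Switching the spin of a vertex attached to `v` from `-1` to `1` changes the mean of `f`
by a multiple of the influence of `v`, since `f` sees the change only through the spin at `v`. -/
lemma mean_sub_mean_single (f : Config V → ℝ) (v : V) :
    mass (fun σ => (F * f) σ * edgeFactor β γ 1 (σ v))
        / mass (fun σ => F σ * edgeFactor β γ 1 (σ v))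
      - mass (fun σ => (F * f) σ * edgeFactor β γ (-1) (σ v))
        / mass (fun σ => F σ * edgeFactor β γ (-1) (σ v))
      = edgeInfluence β γ (spinRatio F v) * influence F f v := by
  have hA := spinMass_nonneg hF v 1
  have hB := spinMass_neg_one_pos hF hF' v
  have hA0 := fun h => spinMass_mul_eq_zero hF (v := v) (x := 1) h f
  simp only [mass_mul_edgeFactor, edgeInfluence, spinRatio, influence]
  have e1 : edgeFactor β γ 1 1 = β := by simp [edgeFactor]
  have e2 : edgeFactor β γ 1 (-1) = 1 := by simp [edgeFactor]
  have e3 : edgeFactor β γ (-1) 1 = 1 := by simp [edgeFactor]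
  have e4 : edgeFactor β γ (-1) (-1) = γ := by simp [edgeFactor]
  rw [e1, e2, e3, e4]
  generalize spinMass F v 1 = A at *
  generalize spinMass F v (-1) = B at *
  generalize spinMass (F * f) v 1 = P at *
  generalize spinMass (F * f) v (-1) = Q at *
  have h1 : 0 < β * A + 1 * B := by positivity
  have h2 : 0 < 1 * A + γ * B := by positivity
  have h3 : 0 < β * (A / B) + 1 := by positivity
  have h4 : 0 < A / B + γ := by positivity
  rcases hA.eq_or_lt with h | h
  · have hP := hA0 h.symm
    subst h; subst hP
    field_simp
    ring
  · have h5 : β * A + B ≠ 0 := by simpa using h1.ne'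
    have h6 : A + γ * B ≠ 0 := by simpa using h2.ne'
    have h7 : A + B * γ ≠ 0 := by rwa [mul_comm B]
    have h3' : β * (A / B) + 1 = (β * A + B) / B := by field_simp
    have h4' : A / B + γ = (A + γ * B) / B := by field_simp
    rw [h3', h4', one_mul, one_mul, one_mul, one_mul]
    field_simp
    ring

lemma mass_div_mass_single (v : V) :
    mass (fun σ => F σ * edgeFactor β γ 1 (σ v)) / mass (fun σ => F σ * edgeFactor β γ (-1) (σ v))
      = (β * spinRatio F v + 1) / (spinRatio F v + γ) := by
  have hA := spinMass_nonneg hF v 1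
  have hB := spinMass_neg_one_pos hF hF' v
  simp only [mass_mul_edgeFactor, spinRatio]
  have e1 : edgeFactor β γ 1 1 = β := by simp [edgeFactor]
  have e2 : edgeFactor β γ 1 (-1) = 1 := by simp [edgeFactor]
  have e3 : edgeFactor β γ (-1) 1 = 1 := by simp [edgeFactor]
  have e4 : edgeFactor β γ (-1) (-1) = γ := by simp [edgeFactor]
  rw [e1, e2, e3, e4]
  generalize spinMass F v 1 = A at *
  generalize spinMass F v (-1) = B at *
  have h3' : β * (A / B) + 1 = (β * A + B) / B := by field_simp
  have h4' : A / B + γ = (A + γ * B) / B := by field_simp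
  rw [h3', h4', one_mul, one_mul, div_div_div_cancel_right₀ hB.ne']

omit hF' in
lemma attach_nonneg (ξ : V → ℤˣ) (N : Finset V) : 0 ≤ attach β γ F ξ N := fun σ =>
  mul_nonneg (hF σ) (Finset.prod_nonneg fun _ _ => edgeFactor_nonneg hβ hγ _ _)

omit hβ hF in
lemma attach_neg_one_pos (ξ : V → ℤˣ) (N : Finset V) :
    0 < attach β γ F ξ N (fun _ => -1) :=
  mul_pos hF' (Finset.prod_pos fun _ _ => edgeFactor_neg_one_pos hγ _)

lemma mass_attach_pos (ξ : V → ℤˣ) (N : Finset V) : 0 < mass (attach β γ F ξ N) :=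
  Finset.sum_pos' (fun σ _ => attach_nonneg hβ hγ hF ξ N σ)
    ⟨_, Finset.mem_univ _, attach_neg_one_pos hγ hF' ξ N⟩

end

lemma attach_congr {β γ : ℝ} (F : Config V → ℝ) {ξ ξ' : V → ℤˣ} {N : Finset V}
    (h : ∀ a ∈ N, ξ a = ξ' a) : attach β γ F ξ N = attach β γ F ξ' N := by
  funext σ
  unfold attach
  rw [Finset.prod_congr rfl fun a ha => by rw [h a ha]]

lemma attach_insert (β γ : ℝ) (F : Config V → ℝ) (ξ : V → ℤˣ) {a : V} {N : Finset V}
    (ha : a ∉ N) :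
    attach β γ F ξ (insert a N) = fun σ => attach β γ F ξ N σ * edgeFactor β γ (ξ a) (σ a) := by
  funext σ
  rw [attach, attach, Finset.prod_insert ha]; ring

lemma attach_insert' (β γ : ℝ) (F : Config V → ℝ) (ξ : V → ℤˣ) {a : V} {N : Finset V}
    (ha : a ∉ N) :
    attach β γ F ξ (insert a N)
      = attach β γ (fun σ => F σ * edgeFactor β γ (ξ a) (σ a)) ξ N := by
  funext σ
  rw [attach, attach, Finset.prod_insert ha]; ring

lemma attach_mul (β γ : ℝ) (F f : Config V → ℝ) (ξ : V → ℤˣ) (N : Finset V) :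
    attach β γ F ξ N * f = attach β γ (F * f) ξ N := by
  funext σ
  simp only [attach, Pi.mul_apply]; ring

lemma attach_copySpin_self {β γ : ℝ} (F : Config V → ℝ) {a : V} {N : Finset V} (ha : a ∉ N)
    (hmax : ∀ x ∈ N, Fintype.equivFin V x ≤ Fintype.equivFin V a) :
    attach β γ F (copySpin a) ((insert a N).erase a) = attach β γ F (fun _ => 1) N := by
  rw [Finset.erase_insert ha]
  refine attach_congr F fun x hx => ?_
  have hne : x ≠ a := fun h => ha (h ▸ hx)
  have : Fintype.equivFin V x < Fintype.equivFin V a :=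
    lt_of_le_of_ne (hmax x hx) fun h => hne ((Fintype.equivFin V).injective h)
  simp [copySpin, this]

lemma attach_copySpin_of_mem {β γ : ℝ} (F : Config V → ℝ) {a u : V} {N : Finset V} (ha : a ∉ N)
    (hmax : ∀ x ∈ N, Fintype.equivFin V x ≤ Fintype.equivFin V a) (hu : u ∈ N) :
    attach β γ F (copySpin u) ((insert a N).erase u)
      = attach β γ (fun σ => F σ * edgeFactor β γ (-1) (σ a)) (copySpin u) (N.erase u) := by
  have hne : u ≠ a := fun h => ha (h ▸ hu)
  rw [Finset.erase_insert_of_ne hne.symm,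
    attach_insert' _ _ _ _ (fun h => ha (Finset.mem_of_mem_erase h))]
  have : copySpin u a = -1 := by simp [copySpin, hmax u hu]
  rw [this]

section

variable {β γ : ℝ} (hβ : 0 ≤ β) (hγ : 0 < γ)

include hβ hγ

/-- Switching the copies of a vertex attached to the vertices of `N` from `-1` to `1`, one after
another, expresses the change of the mean of `f` through the influences of the vertices of `N`. -/
lemma mean_sub_mean_attach (f : Config V → ℝ) (N : Finset V) :
    ∀ F : Config V → ℝ, 0 ≤ F → 0 < F (fun _ => -1) →
      mass (attach β γ F (fun _ => 1) N * f) / mass (attach β γ F (fun _ => 1) N)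
        - mass (attach β γ F (fun _ => -1) N * f) / mass (attach β γ F (fun _ => -1) N)
        = ∑ u ∈ N, edgeInfluence β γ (spinRatio (attach β γ F (copySpin u) (N.erase u)) u)
            * influence (attach β γ F (copySpin u) (N.erase u)) f u := by
  induction N using Finset.induction_on_max_value (Fintype.equivFin V) with
  | empty => intro F _ _; simp [show attach β γ F (fun _ => 1) ∅ = attach β γ F (fun _ => -1) ∅ from
      attach_congr F (by simp)]
  | insert a N ha hmax ih =>
    intro F hF hF'
    have hF1 : 0 ≤ fun σ : Config V => F σ * edgeFactor β γ (-1) (σ a) :=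
      fun σ => mul_nonneg (hF σ) (edgeFactor_nonneg hβ hγ _ _)
    have hF2 : 0 < (fun σ : Config V => F σ * edgeFactor β γ (-1) (σ a)) (fun _ => -1) :=
      mul_pos hF' (edgeFactor_neg_one_pos hγ _)
    rw [Finset.sum_insert ha, attach_copySpin_self F ha hmax,
      Finset.sum_congr rfl fun u hu => by rw [attach_copySpin_of_mem F ha hmax hu],
      ← mean_sub_mean_single hβ hγ (attach_nonneg hβ hγ hF _ _) (attach_neg_one_pos hγ hF' _ _) f a,
      ← ih _ hF1 hF2]
    simp only [attach_mul]
    rw [← attach_insert β γ (F * f) (fun _ => 1) ha, ← attach_insert β γ F (fun _ => 1) ha,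
      ← attach_insert' β γ F (fun _ => -1) ha, attach_insert' β γ (F * f) (fun _ => -1) ha]
    have h1 : (fun σ => attach β γ F (fun _ => 1) N σ * edgeFactor β γ (-1) (σ a))
        = attach β γ (fun σ => F σ * edgeFactor β γ (-1) (σ a)) (fun _ => 1) N := by
      funext σ; simp only [attach]; ring
    have h2 : (fun σ => attach β γ (F * f) (fun _ => 1) N σ * edgeFactor β γ (-1) (σ a))
        = attach β γ ((fun σ => F σ * edgeFactor β γ (-1) (σ a)) * f) (fun _ => 1) N := by
      funext σ; simp only [attach, Pi.mul_apply]; ring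
    have h3 : (fun σ => (F * f) σ * edgeFactor β γ (-1) (σ a))
        = (fun σ => F σ * edgeFactor β γ (-1) (σ a)) * f := by
      funext σ; simp only [Pi.mul_apply]; ring
    rw [h1, h2, h3]
    ring

lemma mass_div_mass_attach (N : Finset V) :
    ∀ F : Config V → ℝ, 0 ≤ F → 0 < F (fun _ => -1) →
      mass (attach β γ F (fun _ => 1) N) / mass (attach β γ F (fun _ => -1) N)
        = ∏ u ∈ N, (β * spinRatio (attach β γ F (copySpin u) (N.erase u)) u + 1)
            / (spinRatio (attach β γ F (copySpin u) (N.erase u)) u + γ) := by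
  induction N using Finset.induction_on_max_value (Fintype.equivFin V) with
  | empty =>
    intro F hF hF'
    rw [Finset.prod_empty, attach_congr F (ξ := fun _ => 1) (ξ' := fun _ => -1) (by simp)]
    exact div_self (mass_attach_pos hβ hγ hF hF' _ ∅).ne'
  | insert a N ha hmax ih =>
    intro F hF hF'
    have hF1 : 0 ≤ fun σ : Config V => F σ * edgeFactor β γ (-1) (σ a) :=
      fun σ => mul_nonneg (hF σ) (edgeFactor_nonneg hβ hγ _ _)
    have hF2 : 0 < (fun σ : Config V => F σ * edgeFactor β γ (-1) (σ a)) (fun _ => -1) :=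
      mul_pos hF' (edgeFactor_neg_one_pos hγ _)
    rw [Finset.prod_insert ha, attach_copySpin_self F ha hmax,
      Finset.prod_congr rfl fun u hu => by rw [attach_copySpin_of_mem F ha hmax hu],
      ← mass_div_mass_single hβ hγ (attach_nonneg hβ hγ hF _ _) (attach_neg_one_pos hγ hF' _ _) a,
      ← ih _ hF1 hF2, ← attach_insert β γ F (fun _ => 1) ha,
      ← attach_insert' β γ F (fun _ => -1) ha]
    have h1 : (fun σ => attach β γ F (fun _ => 1) N σ * edgeFactor β γ (-1) (σ a))
        = attach β γ (fun σ => F σ * edgeFactor β γ (-1) (σ a)) (fun _ => 1) N := by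
      funext σ; simp only [attach]; ring
    rw [h1, div_mul_div_cancel₀ (mass_attach_pos hβ hγ hF1 hF2 _ N).ne']

end

end Telescoping

/-! ### Removing a vertex -/

section Removal

variable {V : Type*} [DecidableEq V]

/-- The neighbours of `v` in `S`. -/
def nbrs (G : SimpleGraph V) [DecidableRel G.Adj] (S : Finset V) (v : V) : Finset V :=
  S.filter (G.Adj v)

/-- The fields on `S.erase v` after the removal of `v`, seen from its neighbour `u`: every other
neighbour of `v` absorbs the edge to its own copy of `v`. -/
def childField [Fintype V] (G : SimpleGraph V) [DecidableRel G.Adj] (β γ : ℝ) (S : Finset V)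
    (φ : V → ℤˣ → ℝ) (v u : V) : V → ℤˣ → ℝ :=
  fun a x => if a ∈ (nbrs G S v).erase u then φ a x * edgeFactor β γ (copySpin u a) x else φ a x

/-- The factor of the pair `e` in the weight of `σ`. -/
def pairFactor (β γ : ℝ) (σ : Config V) (e : Sym2 V) : ℝ :=
  Sym2.lift ⟨fun a b => edgeFactor β γ (σ a) (σ b), fun _ _ => edgeFactor_comm _ _ _ _⟩ e

/-- The weight of the two-spin model on the subgraph induced by `S` with the vertex weights `φ`.
It is a function on the configurations of all of `V` that ignores the spins outside of `S`. -/
def regionWeight [Fintype V] (G : SimpleGraph V) [DecidableRel G.Adj] (β γ : ℝ) (S : Finset V)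
    (φ : V → ℤˣ → ℝ) : Config V → ℝ := fun σ =>
  (∏ a ∈ S, φ a (σ a)) * ∏ e ∈ G.edgeFinset.filter (fun e => ∀ a ∈ e, a ∈ S), pairFactor β γ σ e

/-- `f` does not depend on the spin at `v`. -/
def IgnoresSpin (f : Config V → ℝ) (v : V) : Prop := ∀ σ x, f (Function.update σ v x) = f σ

lemma IgnoresSpin.mul {f g : Config V → ℝ} {v : V} (hf : IgnoresSpin f v)
    (hg : IgnoresSpin g v) : IgnoresSpin (f * g) v := fun σ x => by
  simp only [Pi.mul_apply, hf σ x, hg σ x]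

lemma mem_nbrs {G : SimpleGraph V} [DecidableRel G.Adj] {S : Finset V} {v u : V} :
    u ∈ nbrs G S v ↔ u ∈ S ∧ G.Adj v u := by simp [nbrs]

lemma nbrs_subset_erase (G : SimpleGraph V) [DecidableRel G.Adj] (S : Finset V) (v : V) :
    nbrs G S v ⊆ S.erase v := fun u hu => by
  rw [mem_nbrs] at hu
  exact Finset.mem_erase.2 ⟨hu.2.ne', hu.1⟩

variable [Fintype V]

lemma nbrs_erase_card (G : SimpleGraph V) [DecidableRel G.Adj] {S : Finset V} {v u : V}
    (hv : v ∈ S) : (nbrs G (S.erase v) u).card + (if G.Adj v u then 1 else 0)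
      = (nbrs G S u).card := by
  have : nbrs G (S.erase v) u = (nbrs G S u).erase v := by
    ext a; simp only [mem_nbrs, Finset.mem_erase]; tauto
  rw [this]
  split_ifs with h
  · exact Finset.card_erase_add_one (mem_nbrs.2 ⟨hv, h.symm⟩)
  · rw [Finset.erase_eq_of_notMem, add_zero]
    exact fun h' => h (mem_nbrs.1 h').2.symm

lemma card_nbrs_le (G : SimpleGraph V) [DecidableRel G.Adj] (S : Finset V) (v : V) :
    (nbrs G S v).card ≤ G.maxDegree := by
  refine le_trans (Finset.card_le_card ?_) (G.degree_le_maxDegree v)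
  intro u hu
  simpa using (mem_nbrs.1 hu).2

lemma two_mul_spinMass {f : Config V → ℝ} {v : V} (hf : IgnoresSpin f v) (x : ℤˣ) :
    2 * spinMass f v x = mass f := by
  have key : spinMass f v (-x) = spinMass f v x := by
    unfold spinMass
    refine Finset.sum_nbij' (fun σ => Function.update σ v (-σ v))
      (fun σ => Function.update σ v (-σ v)) (by simp) (by simp) (by simp) (by simp) ?_
    intro σ _
    have : f (Function.update σ v (-σ v)) = f σ := hf σ _
    simp only [Function.update_self, this, neg_eq_iff_eq_neg]
  rw [mass_eq_spinMass_add f v]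
  rcases Int.units_eq_one_or x with rfl | rfl
  · rw [key]; ring
  · rw [neg_neg] at key; rw [key]; ring

variable (G : SimpleGraph V) [DecidableRel G.Adj] (β γ : ℝ)

lemma regionWeight_erase {S : Finset V} {v : V} (hv : v ∈ S) (φ : V → ℤˣ → ℝ) (σ : Config V) :
    regionWeight G β γ S φ σ = φ v (σ v) * ((∏ a ∈ nbrs G S v, edgeFactor β γ (σ v) (σ a))
      * regionWeight G β γ (S.erase v) φ σ) := by
  unfold regionWeight
  have hE : G.edgeFinset.filter (fun e => ∀ a ∈ e, a ∈ S)
      = (nbrs G S v).image (fun u => s(v, u))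
        ∪ G.edgeFinset.filter (fun e => ∀ a ∈ e, a ∈ S.erase v) := by
    ext e
    induction e with | _ a b => ?_
    simp only [Finset.mem_filter, SimpleGraph.mem_edgeFinset, SimpleGraph.mem_edgeSet,
      Sym2.mem_iff, forall_eq_or_imp, forall_eq, Finset.mem_union, Finset.mem_image, mem_nbrs,
      Finset.mem_erase, Sym2.eq_iff]
    constructor
    · rintro ⟨hab, ha, hb⟩
      by_cases h1 : a = v
      · subst h1; exact Or.inl ⟨b, ⟨hb, hab⟩, Or.inl ⟨rfl, rfl⟩⟩
      by_cases h2 : b = v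
      · subst h2; exact Or.inl ⟨a, ⟨ha, hab.symm⟩, Or.inr ⟨rfl, rfl⟩⟩
      exact Or.inr ⟨hab, ⟨h1, ha⟩, h2, hb⟩
    · rintro (⟨u, ⟨hu, hvu⟩, ⟨rfl, rfl⟩ | ⟨rfl, rfl⟩⟩ | ⟨hab, ⟨-, ha⟩, -, hb⟩)
      · exact ⟨hvu, hv, hu⟩
      · exact ⟨hvu.symm, hu, hv⟩
      · exact ⟨hab, ha, hb⟩
  rw [hE, Finset.prod_union, Finset.prod_image, ← Finset.mul_prod_erase S _ hv]
  · simp only [pairFactor, Sym2.lift_mk]; ring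
  · intro a _ b _ h
    exact Sym2.congr_right.1 h
  · rw [Finset.disjoint_left]
    rintro e he he'
    obtain ⟨u, -, rfl⟩ := Finset.mem_image.1 he
    simpa using (Finset.mem_filter.1 he').2 v (by simp)

lemma regionWeight_ignoresSpin {S : Finset V} {v : V} (hv : v ∉ S) (φ : V → ℤˣ → ℝ) :
    IgnoresSpin (regionWeight G β γ S φ) v := by
  intro σ x
  have h : ∀ a ∈ S, Function.update σ v x a = σ a := fun a ha =>
    Function.update_of_ne (ne_of_mem_of_not_mem ha hv) _ _
  unfold regionWeight
  congr 1
  · exact Finset.prod_congr rfl fun a ha => by rw [h a ha]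
  · refine Finset.prod_congr rfl fun e he => ?_
    have he' := (Finset.mem_filter.1 he).2
    induction e with | _ a b => ?_
    simp only [pairFactor, Sym2.lift_mk]
    rw [h a (he' a (by simp)), h b (he' b (by simp))]

lemma attach_regionWeight {S N : Finset V} (hN : N ⊆ S) (φ : V → ℤˣ → ℝ) (ξ : V → ℤˣ) :
    attach β γ (regionWeight G β γ S φ) ξ N
      = regionWeight G β γ S
          (fun a x => if a ∈ N then φ a x * edgeFactor β γ (ξ a) x else φ a x) := by
  funext σ
  unfold attach regionWeight
  have : ∏ a ∈ S, (if a ∈ N then φ a (σ a) * edgeFactor β γ (ξ a) (σ a) else φ a (σ a))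
      = (∏ a ∈ S, φ a (σ a)) * ∏ a ∈ N, edgeFactor β γ (ξ a) (σ a) := by
    rw [← Finset.inter_eq_right.2 hN, ← Finset.filter_mem_eq_inter, Finset.prod_filter,
      ← Finset.prod_mul_distrib]
    refine Finset.prod_congr rfl fun a ha => ?_
    simp only [Finset.mem_filter, ha, true_and]
    split_ifs <;> simp
  rw [this]; ring

lemma attach_copySpin_regionWeight (S : Finset V) (φ : V → ℤˣ → ℝ) (v u : V) :
    attach β γ (regionWeight G β γ (S.erase v) φ) (copySpin u) ((nbrs G S v).erase u)
      = regionWeight G β γ (S.erase v) (childField G β γ S φ v u) :=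
  attach_regionWeight G β γ ((Finset.erase_subset _ _).trans (nbrs_subset_erase G S v)) _ _

lemma spinMass_regionWeight {S : Finset V} {v : V} (hv : v ∈ S) (φ : V → ℤˣ → ℝ)
    {f : Config V → ℝ} (hf : IgnoresSpin f v) (x : ℤˣ) :
    2 * spinMass (regionWeight G β γ S φ * f) v x
      = φ v x * mass (attach β γ (regionWeight G β γ (S.erase v) φ) (fun _ => x) (nbrs G S v)
          * f) := by
  have hig : IgnoresSpin (attach β γ (regionWeight G β γ (S.erase v) φ) (fun _ => x)
      (nbrs G S v) * f) v := by
    refine IgnoresSpin.mul ?_ hf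
    rw [attach_regionWeight G β γ (nbrs_subset_erase G S v)]
    exact regionWeight_ignoresSpin G β γ (Finset.notMem_erase v S) _
  rw [← two_mul_spinMass hig x]
  have : spinMass (regionWeight G β γ S φ * f) v x = φ v x * spinMass (attach β γ
      (regionWeight G β γ (S.erase v) φ) (fun _ => x) (nbrs G S v) * f) v x := by
    unfold spinMass
    rw [Finset.mul_sum]
    refine Finset.sum_congr rfl fun σ _ => ?_
    split_ifs with h
    · simp only [Pi.mul_apply, attach, regionWeight_erase G β γ hv φ σ, h]; ring
    · simp
  rw [this]; ring

lemma spinMass_regionWeight' {S : Finset V} {v : V} (hv : v ∈ S) (φ : V → ℤˣ → ℝ) (x : ℤˣ) :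
    2 * spinMass (regionWeight G β γ S φ) v x
      = φ v x * mass (attach β γ (regionWeight G β γ (S.erase v) φ) (fun _ => x)
          (nbrs G S v)) := by
  have := spinMass_regionWeight G β γ hv φ (f := 1) (fun _ _ => rfl) x
  simpa using this

/-- The ratio of the masses of the two spins at `v` in the region `S` with fields `φ`. -/
def regionRatio (S : Finset V) (φ : V → ℤˣ → ℝ) (v : V) : ℝ :=
  spinRatio (regionWeight G β γ S φ) v

/-- The influence of `v` on the spin of `u` in the region `S` with fields `φ`. -/
def regionInfluence (S : Finset V) (φ : V → ℤˣ → ℝ) (v u : V) : ℝ :=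
  influence (regionWeight G β γ S φ) (fun σ => if σ u = 1 then 1 else 0) v

/-- Vertex weights that leave each spin `-1` on `S` possible. -/
structure IsField (S : Finset V) (φ : V → ℤˣ → ℝ) : Prop where
  nonneg : ∀ a ∈ S, ∀ x, 0 ≤ φ a x
  pos : ∀ a ∈ S, 0 < φ a (-1)

variable {β γ} {S : Finset V} {φ : V → ℤˣ → ℝ} (hβ : 0 ≤ β) (hγ : 0 < γ)

include hβ hγ

omit [DecidableEq V] in
lemma pairFactor_nonneg (σ : Config V) (e : Sym2 V) : 0 ≤ pairFactor β γ σ e := by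
  induction e with | _ a b => exact edgeFactor_nonneg hβ hγ _ _

lemma regionWeight_nonneg (hφ : IsField S φ) : 0 ≤ regionWeight G β γ S φ := fun σ =>
  mul_nonneg (Finset.prod_nonneg fun a ha => hφ.nonneg a ha _)
    (Finset.prod_nonneg fun e _ => pairFactor_nonneg hβ hγ σ e)

omit hβ in
lemma regionWeight_neg_one_pos (hφ : IsField S φ) :
    0 < regionWeight G β γ S φ (fun _ => -1) :=
  mul_pos (Finset.prod_pos fun a ha => hφ.pos a ha)
    (Finset.prod_pos fun e _ => by
      induction e with | _ a b => exact edgeFactor_neg_one_pos (β := β) hγ (-1))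

lemma regionRatio_nonneg (hφ : IsField S φ) (v : V) : 0 ≤ regionRatio G β γ S φ v :=
  spinRatio_nonneg (regionWeight_nonneg G hβ hγ hφ) v

omit hβ hγ in
lemma IsField.erase (hφ : IsField S φ) (v : V) : IsField (S.erase v) φ :=
  ⟨fun a ha => hφ.nonneg a (Finset.mem_of_mem_erase ha),
    fun a ha => hφ.pos a (Finset.mem_of_mem_erase ha)⟩

lemma IsField.childField (hφ : IsField S φ) (v u : V) :
    IsField (S.erase v) (childField G β γ S φ v u) := by
  refine ⟨fun a ha x => ?_, fun a ha => ?_⟩ <;> unfold TwoSpin.childField <;> split_ifs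
  · exact mul_nonneg ((hφ.erase v).nonneg a ha x) (edgeFactor_nonneg hβ hγ _ _)
  · exact (hφ.erase v).nonneg a ha x
  · exact mul_pos ((hφ.erase v).pos a ha) (edgeFactor_neg_one_pos hγ _)
  · exact (hφ.erase v).pos a ha

/-- The recursion for the ratio at a vertex in terms of the ratios at its neighbours after its
removal. -/
lemma regionRatio_eq (hφ : IsField S φ) {v : V} (hv : v ∈ S) :
    regionRatio G β γ S φ v = φ v 1 / φ v (-1) * ∏ u ∈ nbrs G S v,
      (β * regionRatio G β γ (S.erase v) (childField G β γ S φ v u) u + 1)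
        / (regionRatio G β γ (S.erase v) (childField G β γ S φ v u) u + γ) := by
  have h := mass_div_mass_attach hβ hγ (nbrs G S v) _
    (regionWeight_nonneg G hβ hγ (hφ.erase v)) (regionWeight_neg_one_pos G hγ (hφ.erase v))
  simp only [attach_copySpin_regionWeight] at h
  unfold regionRatio
  rw [← h, spinRatio, ← mul_div_mul_left _ _ (two_ne_zero : (2 : ℝ) ≠ 0),
    spinMass_regionWeight' G β γ hv, spinMass_regionWeight' G β γ hv, mul_div_mul_comm]

lemma regionInfluence_eq (hφ : IsField S φ) {v u : V} (hv : v ∈ S) (huv : u ≠ v)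
    (hr : 0 < regionRatio G β γ S φ v) :
    regionInfluence G β γ S φ v u = ∑ a ∈ nbrs G S v,
      edgeInfluence β γ (regionRatio G β γ (S.erase v) (childField G β γ S φ v a) a)
        * regionInfluence G β γ (S.erase v) (childField G β γ S φ v a) a u := by
  have h := mean_sub_mean_attach hβ hγ (fun σ => if σ u = 1 then 1 else 0) (nbrs G S v) _
    (regionWeight_nonneg G hβ hγ (hφ.erase v)) (regionWeight_neg_one_pos G hγ (hφ.erase v))
  simp only [attach_copySpin_regionWeight] at h
  unfold regionInfluence regionRatio
  rw [← h, influence]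
  have hf : IgnoresSpin (fun σ : Config V => if σ u = 1 then (1 : ℝ) else 0) v := fun σ x => by
    simp [Function.update_of_ne huv]
  have h1 : φ v 1 ≠ 0 := by
    intro h0
    rw [regionRatio_eq G hβ hγ hφ hv, h0] at hr
    simp at hr
  have h2 := (hφ.pos v hv).ne'
  have key : ∀ x, φ v x ≠ 0 → spinMass (regionWeight G β γ S φ
      * fun σ => if σ u = 1 then 1 else 0) v x / spinMass (regionWeight G β γ S φ) v x
      = mass (attach β γ (regionWeight G β γ (S.erase v) φ) (fun _ => x) (nbrs G S v)
          * fun σ => if σ u = 1 then 1 else 0)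
        / mass (attach β γ (regionWeight G β γ (S.erase v) φ) (fun _ => x) (nbrs G S v)) := by
    intro x hx
    rw [← mul_div_mul_left _ _ (two_ne_zero : (2 : ℝ) ≠ 0), spinMass_regionWeight' G β γ hv,
      spinMass_regionWeight G β γ hv φ hf, mul_div_mul_left _ _ hx]
  rw [key 1 h1, key (-1) h2]

omit hβ hγ in
lemma abs_regionInfluence_self_le (v : V) : |regionInfluence G β γ S φ v v| ≤ 1 := by
  have h1 : spinMass (regionWeight G β γ S φ * fun σ => if σ v = 1 then 1 else 0) v 1
      = spinMass (regionWeight G β γ S φ) v 1 := by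
    refine Finset.sum_congr rfl fun σ _ => ?_
    split_ifs <;> simp_all
  have h2 : spinMass (regionWeight G β γ S φ * fun σ => if σ v = 1 then 1 else 0) v (-1) = 0 := by
    refine Finset.sum_eq_zero fun σ _ => ?_
    split_ifs with h
    · simp [h]
    · rfl
  unfold regionInfluence influence
  rw [h1, h2, zero_div, sub_zero]
  rcases eq_or_ne (spinMass (regionWeight G β γ S φ) v 1) 0 with h | h
  · simp [h]
  · simp [div_self h]

/-- The sum, over the self-avoiding walks of length `ℓ` from `v` in `S`, of the moduli of the
products of the edge influences along the walk, weighted by `m` at the end of the walk. -/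
def walkSum (G : SimpleGraph V) [DecidableRel G.Adj] (β γ : ℝ) (m : V → ℝ) :
    ℕ → Finset V → (V → ℤˣ → ℝ) → V → ℝ
  | 0, _, _, v => m v
  | ℓ + 1, S, φ, v => ∑ u ∈ nbrs G S v,
      |edgeInfluence β γ (regionRatio G β γ (S.erase v) (childField G β γ S φ v u) u)|
        * walkSum G β γ m ℓ (S.erase v) (childField G β γ S φ v u) u

omit hβ hγ in
lemma walkSum_nonneg {m : V → ℝ} (hm : 0 ≤ m) (ℓ : ℕ) :
    ∀ (S : Finset V) (φ : V → ℤˣ → ℝ) (v : V), 0 ≤ walkSum G β γ m ℓ S φ v := by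
  induction ℓ with
  | zero => intro S φ v; exact hm v
  | succ ℓ ih =>
    intro S φ v
    exact Finset.sum_nonneg fun u _ => mul_nonneg (abs_nonneg _) (ih _ _ _)

/-- The influences of a vertex expand into a sum over self-avoiding walks. -/
theorem sum_abs_regionInfluence_le {m : V → ℝ} (hm : 0 ≤ m) (n : ℕ) :
    ∀ (S : Finset V) (φ : V → ℤˣ → ℝ) (v : V), S.card = n → IsField S φ → v ∈ S →
      0 < regionRatio G β γ S φ v →
      ∑ u ∈ S, |regionInfluence G β γ S φ v u| * m u
        ≤ ∑ ℓ ∈ Finset.range n, walkSum G β γ m ℓ S φ v := by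
  induction n with
  | zero =>
    intro S φ v hS _ hv
    simp [Finset.card_eq_zero.1 hS] at hv
  | succ n ih =>
    intro S φ v hS hφ hv hr
    have hcard : (S.erase v).card = n := by rw [Finset.card_erase_of_mem hv, hS]; rfl
    rw [← Finset.add_sum_erase S _ hv, Finset.sum_range_succ', add_comm]
    refine add_le_add ?_ ?_
    · simp only [walkSum]
      rw [Finset.sum_comm]
      calc ∑ u ∈ S.erase v, |regionInfluence G β γ S φ v u| * m u
          ≤ ∑ u ∈ S.erase v, ∑ a ∈ nbrs G S v,
            |edgeInfluence β γ (regionRatio G β γ (S.erase v) (childField G β γ S φ v a) a)|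
            * (|regionInfluence G β γ (S.erase v) (childField G β γ S φ v a) a u| * m u) := by
            refine Finset.sum_le_sum fun u hu => ?_
            rw [regionInfluence_eq G hβ hγ hφ hv (Finset.ne_of_mem_erase hu) hr]
            refine (mul_le_mul_of_nonneg_right (Finset.abs_sum_le_sum_abs _ _) (hm u)).trans ?_
            rw [Finset.sum_mul]
            exact Finset.sum_le_sum fun a _ => by rw [abs_mul, mul_assoc]
        _ ≤ _ := by
            rw [Finset.sum_comm]
            refine Finset.sum_le_sum fun a ha => ?_
            rw [← Finset.mul_sum, ← Finset.mul_sum]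
            have hφ' := hφ.childField G hβ hγ v a
            rcases (regionRatio_nonneg G hβ hγ hφ' a).eq_or_lt with h | h
            · simp [← h, edgeInfluence]
            · exact mul_le_mul_of_nonneg_left
                (ih _ _ _ hcard hφ' (nbrs_subset_erase G S v ha) h) (abs_nonneg _)
    · exact mul_le_of_le_one_left (hm v) (abs_regionInfluence_self_le G v)

end Removal

/-! ### Contraction by the potential -/

section Contraction

/-- A derivative that is bounded on an open interval satisfies the bound at the end points too,
although it may be discontinuous there. -/
lemma deriv_le_of_forall_mem_Ioo {Ψ : ℝ → ℝ} (hΨ : Differentiable ℝ Ψ) {a b K : ℝ} (hab : a < b)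
    (h : ∀ x ∈ Set.Ioo a b, deriv Ψ x ≤ K) {x : ℝ} (hx : x = a ∨ x = b) : deriv Ψ x ≤ K := by
  have hg : ∀ y, HasDerivAt (fun t => K * t - Ψ t) (K - deriv Ψ y) y := fun y => by
    have := ((hasDerivAt_id y).const_mul K).fun_sub (hΨ y).hasDerivAt
    simpa using this
  have hmono : MonotoneOn (fun t => K * t - Ψ t) (Set.Icc a b) := by
    refine monotoneOn_of_deriv_nonneg (convex_Icc a b)
      (fun y _ => (hg y).continuousAt.continuousWithinAt)
      (fun y _ => (hg y).differentiableAt.differentiableWithinAt) fun y hy => ?_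
    rw [interior_Icc] at hy
    rw [(hg y).deriv]
    linarith [h y hy]
  have hxm : x ∈ Set.Icc a b := by
    rcases hx with rfl | rfl
    · exact ⟨le_rfl, hab.le⟩
    · exact ⟨hab.le, le_rfl⟩
  have h0 : 0 ≤ derivWithin (fun t => K * t - Ψ t) (Set.Icc a b) x := hmono.derivWithin_nonneg
  rw [(hg x).hasDerivWithinAt.derivWithin (uniqueDiffOn_Icc hab x hxm)] at h0
  linarith

/-- The bound on the derivative at log-ratios with a child of finite log-ratio extends to
children that are pinned, whose factors are the limits `β` and `γ⁻¹`. -/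
lemma deriv_le_of_pinned_child {Ψ : ℝ → ℝ} (hΨ : Differentiable ℝ Ψ) {β γ T x e K : ℝ}
    (hβ : 0 ≤ β) (hγ : 0 < γ) (hT : 0 < T) (hne : β * γ ≠ 1) (he : e = β ∨ e = γ⁻¹)
    (hx : Real.exp x = T * e)
    (h : ∀ z r : ℝ, 0 < r → Real.exp z = T * ((β * r + 1) / (r + γ)) → deriv Ψ z ≤ K) :
    deriv Ψ x ≤ K := by
  have he0 : 0 < e := by
    have := Real.exp_pos x
    rw [hx] at this
    exact (pos_iff_pos_of_mul_pos this).1 hT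
  have hγ1 : 0 < 1 + γ := by positivity
  -- The value of the factor at `r = 1` lies strictly between its limits `β` and `γ⁻¹`.
  obtain ⟨g, hg⟩ : ∃ g, g = (β + 1) / (1 + γ) := ⟨_, rfl⟩
  have hg0 : 0 < g := by rw [hg]; positivity
  have hgβ : (g - β) * (1 + γ) = 1 - β * γ := by rw [hg]; field_simp; ring
  have hgγ : (1 - g * γ) * (1 + γ) = 1 - β * γ := by rw [hg]; field_simp; ring
  have hsolve : ∀ a, 0 < (a - β) * (1 - a * γ) → ∀ z, Real.exp z = T * a → deriv Ψ z ≤ K := by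
    intro a ha z hz
    have h1 : a - β ≠ 0 := fun h0 => by simp [h0] at ha
    refine h z ((1 - a * γ) / (a - β)) ?_ ?_
    · have : (1 - a * γ) / (a - β) = ((a - β) * (1 - a * γ)) / (a - β) ^ 2 := by field_simp
      rw [this]; positivity
    · have h2 : β * ((1 - a * γ) / (a - β)) + 1 = a * (1 - β * γ) / (a - β) := by
        field_simp; ring
      have h3 : (1 - a * γ) / (a - β) + γ = (1 - β * γ) / (a - β) := by
        field_simp; ring
      have h4 : 1 - β * γ ≠ 0 := fun h0 => hne (by linarith)
      rw [hz, h2, h3, div_div_div_cancel_right₀ h1, mul_div_assoc, div_self h4, mul_one]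
  have hexp : ∀ z, Real.exp z = T * (Real.exp z / T) := fun z => by field_simp
  have hexpx : Real.exp x / T = e := by rw [hx]; field_simp
  have hy : Real.exp (Real.log (T * g)) / T = g := by
    rw [Real.exp_log (by positivity)]; field_simp
  have hsign : ∀ a, (e < a ∧ a < g) ∨ (g < a ∧ a < e) → 0 < (a - β) * (1 - a * γ) := by
    intro a ha
    have hγe : e = γ⁻¹ → 1 - e * γ = 0 := fun h0 => by rw [h0]; field_simp; ring
    rcases he with he | he
    · subst he
      rcases ha with ⟨h1, h2⟩ | ⟨h1, h2⟩
      · refine mul_pos (by linarith) ?_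
        have : 0 < (g - e) * (1 + γ) := mul_pos (by linarith) hγ1
        have h5 : 0 < 1 - g * γ := (pos_iff_pos_of_mul_pos (by rw [hgγ, ← hgβ]; exact this)).2 hγ1
        nlinarith
      · refine mul_pos_of_neg_of_neg (by linarith) ?_
        have : (g - e) * (1 + γ) < 0 := mul_neg_of_neg_of_pos (by linarith) hγ1
        have h5 : 1 - g * γ < 0 := by
          by_contra h6
          have := mul_nonneg (not_lt.1 h6) hγ1.le
          linarith
        nlinarith
    · have h0 := hγe he
      rcases ha with ⟨h1, h2⟩ | ⟨h1, h2⟩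
      · have h3 : 1 - g * γ < 0 := by nlinarith
        have h4 : (1 - g * γ) * (1 + γ) < 0 := mul_neg_of_neg_of_pos h3 hγ1
        have h5 : g - β < 0 := by
          by_contra h6
          have := mul_nonneg (not_lt.1 h6) hγ1.le
          linarith
        exact mul_pos_of_neg_of_neg (by linarith) (by nlinarith)
      · have h3 : 0 < 1 - g * γ := by nlinarith
        have h4 : 0 < (1 - g * γ) * (1 + γ) := mul_pos h3 hγ1
        have h5 : 0 < g - β := (pos_iff_pos_of_mul_pos (by rw [hgβ, ← hgγ]; exact h4)).2 hγ1
        exact mul_pos (by linarith) (by nlinarith)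
  have hlt : ∀ {z w : ℝ}, z < w → Real.exp z / T < Real.exp w / T := fun hzw =>
    div_lt_div_of_pos_right (Real.exp_lt_exp.2 hzw) hT
  rcases lt_trichotomy x (Real.log (T * g)) with hlt' | heq | hgt
  · refine deriv_le_of_forall_mem_Ioo hΨ hlt' (fun z hz => hsolve _ (hsign _ (Or.inl ⟨?_, ?_⟩)) z
      (hexp z)) (Or.inl rfl)
    · rw [← hexpx]; exact hlt hz.1
    · rw [← hy]; exact hlt hz.2
  · refine h x 1 one_pos ?_
    rw [hexp x, heq, hy, hg, mul_one]
  · refine deriv_le_of_forall_mem_Ioo hΨ hgt (fun z hz => hsolve _ (hsign _ (Or.inr ⟨?_, ?_⟩)) z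
      (hexp z)) (Or.inr rfl)
    · rw [← hy]; exact hlt hz.1
    · rw [← hexpx]; exact hlt hz.2

lemma logRatioDeriv_log {β γ r : ℝ} (hr : 0 < r) :
    logRatioDeriv β γ (Real.log r) = edgeInfluence β γ r := by
  rw [logRatioDeriv, edgeInfluence, Real.exp_log hr]
  congr 1; ring

lemma abs_edgeInfluence_le_one {β γ r : ℝ} (hβ : 0 ≤ β) (hγ : 0 < γ) (hr : 0 ≤ r) :
    |edgeInfluence β γ r| ≤ 1 := by
  have h : 0 < (β * r + 1) * (r + γ) := by positivity
  have h1 : 0 ≤ β * r ^ 2 := by positivity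
  have h2 : 0 ≤ β * γ * r := by positivity
  rw [edgeInfluence, abs_div, abs_of_pos h, div_le_one h, abs_le]
  constructor <;> nlinarith

variable {s δ c β γ lam : ℝ} {Δ : ℕ} {Ψ : ℝ → ℝ}

/-- The contraction property for a vertex that has, besides `n` children of finite log-ratios,
`p` children pinned to `1` and `q` children pinned to `-1`. -/
lemma IsPotential.contraction_of_pinned (hP : IsPotential s δ c Δ β γ lam Ψ) (hs : 1 ≤ s)
    (hδ : 0 ≤ δ) (hβ : 0 ≤ β) (hγ : 0 < γ) (hlam : 0 < lam) (q : ℕ) :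
    ∀ (p n : ℕ) (y m : Fin n → ℝ), (∀ j, 0 ≤ m j) → n + p + q < Δ → ∀ x : ℝ,
      Real.exp x = lam * β ^ p * γ⁻¹ ^ q
        * ∏ i, (β * Real.exp (y i) + 1) / (Real.exp (y i) + γ) →
      deriv Ψ x * ∑ j, |logRatioDeriv β γ (y j)| / deriv Ψ (y j) * m j
        ≤ δ ^ (1 / s) * (∑ j, m j ^ s) ^ (1 / s) := by
  have hfac : ∀ t : ℝ, 0 < (β * Real.exp t + 1) / (Real.exp t + γ) := fun t => by positivity
  have hR : ∀ {n : ℕ} (m : Fin n → ℝ), (∀ j, 0 ≤ m j) →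
      0 ≤ δ ^ (1 / s) * (∑ j, m j ^ s) ^ (1 / s) := fun m hm =>
    mul_nonneg (Real.rpow_nonneg hδ _) (Real.rpow_nonneg
      (Finset.sum_nonneg fun j _ => Real.rpow_nonneg (hm j) _) _)
  -- One child pinned to a spin with factor `e` is the limit of a child of finite log-ratio.
  have step : ∀ (e T₀ : ℝ), 0 ≤ T₀ → (e = β ∨ e = γ⁻¹) → ∀ (n : ℕ) (y m : Fin n → ℝ),
      (∀ j, 0 ≤ m j) →
      (∀ (y' m' : Fin (n + 1) → ℝ), (∀ j, 0 ≤ m' j) → ∀ x : ℝ,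
        Real.exp x = T₀ * ∏ i, (β * Real.exp (y' i) + 1) / (Real.exp (y' i) + γ) →
        deriv Ψ x * ∑ j, |logRatioDeriv β γ (y' j)| / deriv Ψ (y' j) * m' j
          ≤ δ ^ (1 / s) * (∑ j, m' j ^ s) ^ (1 / s)) →
      ∀ x : ℝ, Real.exp x = T₀ * e * ∏ i, (β * Real.exp (y i) + 1) / (Real.exp (y i) + γ) →
      deriv Ψ x * ∑ j, |logRatioDeriv β γ (y j)| / deriv Ψ (y j) * m j
          ≤ δ ^ (1 / s) * (∑ j, m j ^ s) ^ (1 / s) := by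
    intro e T₀ hT₀ he n y m hm ih x hx
    have hS : 0 ≤ ∑ j, |logRatioDeriv β γ (y j)| / deriv Ψ (y j) * m j :=
      Finset.sum_nonneg fun j _ =>
        mul_nonneg (div_nonneg (abs_nonneg _) (hP.deriv_pos _).le) (hm j)
    rcases hS.eq_or_lt with h0 | h0
    · rw [← h0, mul_zero]; exact hR m hm
    have hne : β * γ ≠ 1 := by
      intro h1
      simp [logRatioDeriv, h1] at h0
    have hprod : 0 < ∏ i, (β * Real.exp (y i) + 1) / (Real.exp (y i) + γ) :=
      Finset.prod_pos fun i _ => hfac _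
    have hT₀' : 0 < T₀ := by
      refine hT₀.lt_of_ne fun h => ?_
      have := Real.exp_pos x
      rw [hx, ← h] at this
      simp at this
    rw [← le_div_iff₀ h0]
    refine deriv_le_of_pinned_child hP.differentiable hβ hγ (mul_pos hT₀' hprod) hne he
      (by rw [hx]; ring) fun z r hr hz => ?_
    rw [le_div_iff₀ h0]
    have := ih (Fin.cons (Real.log r) y) (Fin.cons 0 m)
      (fun j => by refine Fin.cases ?_ (fun j => ?_) j <;> simp [hm]) z (by
        rw [Fin.prod_univ_succ]; simp only [Fin.cons_zero, Fin.cons_succ, Real.exp_log hr]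
        rw [hz]; ring)
    rw [Fin.sum_univ_succ, Fin.sum_univ_succ] at this
    simpa only [Fin.cons_zero, Fin.cons_succ, mul_zero, zero_add,
      Real.zero_rpow (by linarith : s ≠ 0)] using this
  induction q with
  | zero =>
    intro p
    induction p with
    | zero =>
      intro n y m hm hn x hx
      rcases Nat.eq_zero_or_pos n with rfl | hn0
      · simpa using hR m hm
      · have : x = logRecursion β γ lam y := by
          rw [← Real.log_exp x, hx, logRecursion, pow_zero, pow_zero, mul_one, mul_one,
            Real.log_mul hlam.ne' (Finset.prod_pos fun i _ => hfac _).ne',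
            Real.log_prod fun i _ => (hfac _).ne']
        rw [this]
        exact hP.contraction n hn0 (by omega) y m hm
    | succ p ih =>
      intro n y m hm hn x hx
      refine step β (lam * β ^ p * γ⁻¹ ^ 0) (by positivity) (Or.inl rfl) n y m hm
        (fun y' m' hm' x' hx' => ih (n + 1) y' m' hm' (by omega) x' hx') x ?_
      rw [hx]; ring
  | succ q ih =>
    intro p n y m hm hn x hx
    refine step γ⁻¹ (lam * β ^ p * γ⁻¹ ^ q) (by positivity) (Or.inr rfl) n y m hm
      (fun y' m' hm' x' hx' => ih p (n + 1) y' m' hm' (by omega) x' hx') x ?_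
    rw [hx]; ring

/-- The contraction property in terms of the ratios `r i` of the children, which may vanish. -/
lemma IsPotential.contraction_ratio (hP : IsPotential s δ c Δ β γ lam Ψ) (hs : 1 ≤ s)
    (hδ : 0 ≤ δ) (hβ : 0 ≤ β) (hγ : 0 < γ) (hlam : 0 < lam) {ι : Type*} (D : Finset ι)
    {p q : ℕ} {r m : ι → ℝ} (hr : ∀ i ∈ D, 0 ≤ r i) (hm : ∀ i ∈ D, 0 ≤ m i)
    (hd : p + q + D.card < Δ) {x : ℝ}
    (hx : Real.exp x = lam * β ^ p * γ⁻¹ ^ q * ∏ i ∈ D, (β * r i + 1) / (r i + γ)) :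
    deriv Ψ x * ∑ i ∈ D, |edgeInfluence β γ (r i)| / deriv Ψ (Real.log (r i)) * m i
      ≤ δ ^ (1 / s) * (∑ i ∈ D, m i ^ s) ^ (1 / s) := by
  classical
  set D₀ := D.filter fun i => ¬ 0 < r i with hD₀
  set D₁ := D.filter fun i => 0 < r i with hD₁
  have hcard : D₁.card + D₀.card = D.card := Finset.card_filter_add_card_filter_not _
  have hz : ∀ i ∈ D₀, r i = 0 := fun i hi => by
    rw [hD₀, Finset.mem_filter] at hi
    exact le_antisymm (not_lt.1 hi.2) (hr i hi.1)
  have hpos : ∀ i ∈ D₁, 0 < r i := fun i hi => (Finset.mem_filter.1 hi).2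
  have hprod : ∏ i ∈ D, (β * r i + 1) / (r i + γ)
      = γ⁻¹ ^ D₀.card * ∏ i ∈ D₁, (β * r i + 1) / (r i + γ) := by
    rw [← Finset.prod_filter_mul_prod_filter_not D (fun i => 0 < r i), mul_comm]
    congr 1
    refine Finset.prod_eq_pow_card fun i hi => ?_
    rw [hz i hi]; simp
  have hsum : ∑ i ∈ D, |edgeInfluence β γ (r i)| / deriv Ψ (Real.log (r i)) * m i
      = ∑ i ∈ D₁, |edgeInfluence β γ (r i)| / deriv Ψ (Real.log (r i)) * m i := by
    rw [← Finset.sum_filter_add_sum_filter_not D (fun i => 0 < r i), add_eq_left]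
    refine Finset.sum_eq_zero fun i hi => ?_
    rw [hz i hi]; simp [edgeInfluence]
  let e := D₁.equivFin.symm
  have key := hP.contraction_of_pinned hs hδ hβ hγ hlam (q + D₀.card) p D₁.card
    (fun j => Real.log (r (e j))) (fun j => m (e j))
    (fun j => hm _ (Finset.mem_filter.1 (e j).2).1) (by omega) x (by
      rw [hx, hprod, ← Finset.prod_coe_sort D₁, ← e.prod_comp, pow_add]
      simp only [Real.exp_log (hpos _ (e _).2)]
      ring)
  rw [hsum]
  simp only [logRatioDeriv_log (hpos _ (e _).2)] at key
  rw [e.sum_comp (fun i : D₁ => |edgeInfluence β γ (r i)| / deriv Ψ (Real.log (r i)) * m i),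
    e.sum_comp (fun i : D₁ => m i ^ s), Finset.sum_coe_sort D₁ (fun i => m i ^ s),
    Finset.sum_coe_sort D₁
      (fun i => |edgeInfluence β γ (r i)| / deriv Ψ (Real.log (r i)) * m i)] at key
  refine key.trans (mul_le_mul_of_nonneg_left (Real.rpow_le_rpow ?_ ?_ (by positivity))
    (Real.rpow_nonneg hδ _))
  · exact Finset.sum_nonneg fun i hi => Real.rpow_nonneg (hm i (Finset.mem_filter.1 hi).1) _
  · exact Finset.sum_le_sum_of_subset_of_nonneg (Finset.filter_subset _ _)
      fun i hi _ => Real.rpow_nonneg (hm i hi) _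

lemma mem_logRatioRange (hβ : 0 ≤ β) (hγ : 0 < γ) (hlam : 0 < lam) {ι : Type*} {D : Finset ι}
    {p q : ℕ} {r : ι → ℝ} (hr : ∀ i ∈ D, 0 ≤ r i) (hd : p + q + D.card < Δ)
    (hd' : 1 ≤ D.card) {x : ℝ}
    (hx : Real.exp x = lam * β ^ p * γ⁻¹ ^ q * ∏ i ∈ D, (β * r i + 1) / (r i + γ)) :
    x ∈ logRatioRange Δ β γ lam := by
  simp only [logRatioRange, Set.mem_iUnion, logRatioInterval, Set.mem_ofPred_eq]
  refine ⟨p + q + D.card, ⟨by omega, hd⟩, ?_⟩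
  have e1 : lam * β ^ (p + q + D.card) = lam * (β ^ p * β ^ q * β ^ D.card) := by ring
  have e2 : lam / γ ^ (p + q + D.card) = lam * (γ⁻¹ ^ p * γ⁻¹ ^ q * γ⁻¹ ^ D.card) := by
    rw [div_eq_mul_inv, ← inv_pow]; ring
  have hγ' : 0 < γ⁻¹ := by positivity
  have hx' : Real.exp x = lam * (β ^ p * γ⁻¹ ^ q * ∏ i ∈ D, (β * r i + 1) / (r i + γ)) := by
    rw [hx]; ring
  rw [hx', e1, e2, Set.mem_uIcc]
  have hg0 : ∀ i ∈ D, 0 ≤ (β * r i + 1) / (r i + γ) := fun i hi => by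
    have := hr i hi
    positivity
  rcases le_total (β * γ) 1 with h | h
  · left
    have hle : β ≤ γ⁻¹ := by rw [← one_div, le_div_iff₀ hγ]; exact h
    have h1 : ∀ i ∈ D, β ≤ (β * r i + 1) / (r i + γ) := fun i hi => by
      have := hr i hi
      rw [le_div_iff₀ (by positivity)]; nlinarith
    have h2 : ∀ i ∈ D, (β * r i + 1) / (r i + γ) ≤ γ⁻¹ := fun i hi => by
      have := hr i hi
      rw [div_le_iff₀ (by positivity), inv_mul_eq_div, le_div_iff₀ hγ]; nlinarith
    have h3 := Finset.prod_le_prod (fun _ _ => hβ) h1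
    have h4 := Finset.prod_le_prod hg0 h2
    rw [Finset.prod_const] at h3 h4
    constructor
    · gcongr
    · have := Finset.prod_nonneg hg0
      gcongr
  · right
    have hle : γ⁻¹ ≤ β := by rw [inv_le_iff_one_le_mul₀ hγ]; exact h
    have h1 : ∀ i ∈ D, (β * r i + 1) / (r i + γ) ≤ β := fun i hi => by
      have := hr i hi
      rw [div_le_iff₀ (by positivity)]; nlinarith
    have h2 : ∀ i ∈ D, γ⁻¹ ≤ (β * r i + 1) / (r i + γ) := fun i hi => by
      have := hr i hi
      rw [le_div_iff₀ (by positivity), inv_mul_eq_div, div_le_iff₀ hγ]; nlinarith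
    have h3 := Finset.prod_le_prod hg0 h1
    have h4 := Finset.prod_le_prod (fun _ _ => hγ'.le) h2
    rw [Finset.prod_const] at h3 h4
    constructor
    · gcongr
    · have := Finset.prod_nonneg hg0
      gcongr

end Contraction

/-! ### Walk sums and numbers of walks -/

section WalkSum

variable {V : Type*} [Fintype V] [DecidableEq V] (G : SimpleGraph V) [DecidableRel G.Adj]

/-- The sum of `f` over the ends of the self-avoiding walks of length `ℓ` from `v` in `S`. -/
def walkCount (f : V → ℝ) : ℕ → Finset V → V → ℝ
  | 0, _, v => f v
  | ℓ + 1, S, v => ∑ u ∈ nbrs G S v, walkCount f ℓ (S.erase v) u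

lemma walkCount_nonneg {f : V → ℝ} (hf : 0 ≤ f) (ℓ : ℕ) :
    ∀ (S : Finset V) (v : V), 0 ≤ walkCount G f ℓ S v := by
  induction ℓ with
  | zero => intro S v; exact hf v
  | succ ℓ ih => intro S v; exact Finset.sum_nonneg fun u _ => ih _ _

lemma walkCount_mono {f : V → ℝ} (hf : 0 ≤ f) (ℓ : ℕ) :
    ∀ {S T : Finset V} (_ : S ⊆ T) (v : V), walkCount G f ℓ S v ≤ walkCount G f ℓ T v := by
  induction ℓ with
  | zero => intro S T _ v; exact le_rfl
  | succ ℓ ih =>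
    intro S T h v
    refine (Finset.sum_le_sum fun u _ => ih (Finset.erase_subset_erase v h) u).trans
      (Finset.sum_le_sum_of_subset_of_nonneg (Finset.filter_subset_filter _ h) fun u _ _ => ?_)
    exact walkCount_nonneg G hf _ _ _

/-- The field at `a` is `lam`, up to a common factor of both spins, after `p` neighbours pinned to
`1` and `q` neighbours pinned to `-1` have been absorbed; together with the neighbours in `S` these
are at most `D`. -/
def FieldBound (β γ lam : ℝ) (S : Finset V) (φ : V → ℤˣ → ℝ) (a : V) (D : ℕ) : Prop :=
  ∃ p q : ℕ, φ a 1 = lam * β ^ p * γ⁻¹ ^ q * φ a (-1) ∧ p + q + (nbrs G S a).card ≤ D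

variable {G} {s δ c β γ lam : ℝ} {Δ : ℕ} {Ψ : ℝ → ℝ}

/-- Absorbing an edge to a pinned vertex `v` turns `v` from a neighbour in `S` into a pinned
neighbour. -/
lemma FieldBound.absorb (hγ : 0 < γ) {S : Finset V} {φ φ' : V → ℤˣ → ℝ} {v a : V} {D : ℕ}
    (h : FieldBound G β γ lam S φ a D) (hv : v ∈ S) {y : ℤˣ}
    (hφ' : ∀ x, φ' a x = if G.Adj v a then φ a x * edgeFactor β γ y x else φ a x) :
    FieldBound G β γ lam (S.erase v) φ' a D := by
  obtain ⟨p, q, h1, h2⟩ := h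
  have h3 := nbrs_erase_card G (u := a) hv
  by_cases ha : G.Adj v a
  · simp only [ha, if_true] at hφ' h3
    rcases Int.units_eq_one_or y with rfl | rfl
    · refine ⟨p + 1, q, ?_, by omega⟩
      rw [hφ', hφ', h1]
      simp only [edgeFactor, if_true, show (-1 : ℤˣ) ≠ 1 by decide, if_false]
      ring
    · refine ⟨p, q + 1, ?_, by omega⟩
      rw [hφ', hφ', h1]
      simp only [edgeFactor, if_true, show (-1 : ℤˣ) ≠ 1 by decide, if_false]
      rw [pow_succ]
      have : γ⁻¹ * γ = 1 := inv_mul_cancel₀ hγ.ne'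
      linear_combination (-(lam * β ^ p * γ⁻¹ ^ q * φ a (-1))) * this
  · simp only [ha, if_false] at hφ' h3
    exact ⟨p, q, by rw [hφ', hφ', h1], by omega⟩

lemma FieldBound.childField (hγ : 0 < γ) {S : Finset V} {φ : V → ℤˣ → ℝ} {v u a : V} {D : ℕ}
    (h : FieldBound G β γ lam S φ a D) (hv : v ∈ S) (ha : a ∈ S.erase v) (hau : a ≠ u) :
    FieldBound G β γ lam (S.erase v) (TwoSpin.childField G β γ S φ v u) a D := by
  refine h.absorb hγ hv (y := copySpin u a) fun x => ?_
  simp [TwoSpin.childField, mem_nbrs, hau, Finset.mem_of_mem_erase ha]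

/-- The child at which the walk continues loses a neighbour without acquiring a pinned one. -/
lemma FieldBound.childField_self {S : Finset V} {φ : V → ℤˣ → ℝ} {v u : V} {D : ℕ}
    (h : FieldBound G β γ lam S φ u D) (hv : v ∈ S) (hu : u ∈ nbrs G S v) :
    FieldBound G β γ lam (S.erase v) (TwoSpin.childField G β γ S φ v u) u (D - 1) := by
  obtain ⟨p, q, h1, h2⟩ := h
  have h3 := nbrs_erase_card G (u := u) hv
  rw [if_pos (mem_nbrs.1 hu).2] at h3
  exact ⟨p, q, by simpa [TwoSpin.childField] using h1, by omega⟩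

lemma FieldBound.forall_childField (hγ : 0 < γ) {S : Finset V} {φ : V → ℤˣ → ℝ} {v u : V}
    {D : ℕ} (h : ∀ a ∈ S, FieldBound G β γ lam S φ a D) (hv : v ∈ S) (hu : u ∈ nbrs G S v) :
    ∀ a ∈ S.erase v, FieldBound G β γ lam (S.erase v) (TwoSpin.childField G β γ S φ v u) a D := by
  intro a ha
  rcases eq_or_ne a u with rfl | hau
  · obtain ⟨p, q, h1, h2⟩ := (h a (Finset.mem_of_mem_erase ha)).childField_self hv hu
    exact ⟨p, q, h1, by omega⟩
  · exact (h a (Finset.mem_of_mem_erase ha)).childField hγ hv ha hau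

lemma sum_le_card_mul_rpow_sum {ι : Type*} (D : Finset ι) {x : ι → ℝ} (hx : ∀ i ∈ D, 0 ≤ x i)
    (hs : 0 < s) : ∑ i ∈ D, x i ≤ D.card * (∑ i ∈ D, x i ^ s) ^ (1 / s) := by
  rw [← nsmul_eq_mul]
  refine Finset.sum_le_card_nsmul _ _ _ fun i hi => ?_
  calc x i = (x i ^ s) ^ (1 / s) := by
        rw [← Real.rpow_mul (hx i hi), mul_one_div_cancel hs.ne', Real.rpow_one]
    _ ≤ _ := Real.rpow_le_rpow (Real.rpow_nonneg (hx i hi) _)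
        (Finset.single_le_sum (f := fun i => x i ^ s) (fun j hj => Real.rpow_nonneg (hx j hj) _) hi)
        (by positivity)

lemma exp_log_regionRatio (hβ : 0 ≤ β) (hγ : 0 < γ) {S : Finset V} {φ : V → ℤˣ → ℝ} {v : V}
    (hφ : IsField S φ) (hv : v ∈ S) (hr : 0 < regionRatio G β γ S φ v) {p q : ℕ}
    (hpq : φ v 1 = lam * β ^ p * γ⁻¹ ^ q * φ v (-1)) :
    Real.exp (Real.log (regionRatio G β γ S φ v)) = lam * β ^ p * γ⁻¹ ^ q * ∏ u ∈ nbrs G S v,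
      (β * regionRatio G β γ (S.erase v) (childField G β γ S φ v u) u + 1)
        / (regionRatio G β γ (S.erase v) (childField G β γ S φ v u) u + γ) := by
  rw [Real.exp_log hr, regionRatio_eq G hβ hγ hφ hv, hpq, mul_div_cancel_right₀ _ (hφ.pos v hv).ne']

lemma log_regionRatio_mem (hβ : 0 ≤ β) (hγ : 0 < γ) (hlam : 0 < lam) (hΔ : 1 < Δ) {S : Finset V}
    {φ : V → ℤˣ → ℝ} {v : V} (hφ : IsField S φ) (hv : v ∈ S)
    (hr : 0 < regionRatio G β γ S φ v) (hb : FieldBound G β γ lam S φ v (Δ - 1))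
    (hne : (nbrs G S v).Nonempty) :
    Real.log (regionRatio G β γ S φ v) ∈ logRatioRange Δ β γ lam := by
  obtain ⟨p, q, h1, h2⟩ := hb
  exact mem_logRatioRange hβ hγ hlam
    (fun u _ => regionRatio_nonneg G hβ hγ (hφ.childField G hβ hγ v u) u) (by omega)
    hne.card_pos (exp_log_regionRatio hβ hγ hφ hv hr h1)

lemma walkSum_one_le (hβ : 0 ≤ β) (hγ : 0 < γ) (hs : 0 < s) (hΔ : G.maxDegree ≤ Δ) {m : V → ℝ}
    (hm : 0 ≤ m) {S : Finset V} {φ : V → ℤˣ → ℝ} {v : V} (hφ : IsField S φ) :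
    walkSum G β γ m 1 S φ v ≤ Δ * walkCount G (fun a => m a ^ s) 1 S v ^ (1 / s) := by
  simp only [walkSum, walkCount]
  calc _ ≤ ∑ u ∈ nbrs G S v, m u := Finset.sum_le_sum fun u _ =>
        mul_le_of_le_one_left (hm u) (abs_edgeInfluence_le_one hβ hγ
          (regionRatio_nonneg G hβ hγ (hφ.childField G hβ hγ v u) u))
    _ ≤ _ := sum_le_card_mul_rpow_sum _ (fun u _ => hm u) hs
    _ ≤ _ := by
        refine mul_le_mul_of_nonneg_right ?_ (Real.rpow_nonneg
          (Finset.sum_nonneg fun u _ => Real.rpow_nonneg (hm u) _) _)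
        exact_mod_cast (card_nbrs_le G S v).trans hΔ

/-- Contraction of walk sums at a vertex with at most `Δ - 1` children. The factor `κ` stands for
`|h(y)| / χ(y)`, where `y` is the log-ratio at the start of the walk. -/
theorem IsPotential.walkSum_le (hP : IsPotential s δ c Δ β γ lam Ψ) (hs : 1 ≤ s)
    (hδ : 0 ≤ δ) (hc : 0 ≤ c) (hβ : 0 ≤ β) (hγ : 0 < γ) (hlam : 0 < lam) (hΔ1 : 1 < Δ)
    (hΔ : G.maxDegree ≤ Δ) {m : V → ℝ} (hm : 0 ≤ m) {κ : ℝ} (hκ : 0 ≤ κ)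
    (hκc : ∀ z ∈ logRatioRange Δ β γ lam, κ * deriv Ψ z ≤ c) (ℓ : ℕ) :
    ∀ (S : Finset V) (φ : V → ℤˣ → ℝ) (v : V), IsField S φ →
      (∀ a ∈ S, FieldBound G β γ lam S φ a Δ) → v ∈ S → FieldBound G β γ lam S φ v (Δ - 1) →
      0 < regionRatio G β γ S φ v →
      κ * deriv Ψ (Real.log (regionRatio G β γ S φ v)) * walkSum G β γ m (ℓ + 1) S φ v
        ≤ c * Δ * (δ ^ ℓ * walkCount G (fun a => m a ^ s) (ℓ + 1) S v) ^ (1 / s) := by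
  have hs0 : 0 < s := by linarith
  have hms : 0 ≤ fun a => m a ^ s := fun a => Real.rpow_nonneg (hm a) _
  induction ℓ with
  | zero =>
    intro S φ v hφ _ hv hb hr
    rcases (nbrs G S v).eq_empty_or_nonempty with h0 | hne
    · simp [walkSum, walkCount, h0, (by positivity : s ≠ 0)]
    · rw [pow_zero, one_mul, mul_assoc c]
      exact mul_le_mul (hκc _ (log_regionRatio_mem hβ hγ hlam hΔ1 hφ hv hr hb hne))
        (walkSum_one_le hβ hγ hs0 hΔ hm hφ) (walkSum_nonneg G hm _ _ _ _) hc
  | succ ℓ ih =>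
    intro S φ v hφ hB hv hb hr
    obtain ⟨p, q, hpq, hd⟩ := hb
    set r : V → ℝ := fun u => regionRatio G β γ (S.erase v) (childField G β γ S φ v u) u with hrdef
    have hr0 : ∀ u, 0 ≤ r u := fun u =>
      regionRatio_nonneg G hβ hγ (hφ.childField G hβ hγ v u) u
    let A : V → ℝ := fun u => walkSum G β γ m (ℓ + 1) (S.erase v) (childField G β γ S φ v u) u
    let W : V → ℝ := fun u => walkCount G (fun a => m a ^ s) (ℓ + 1) (S.erase v) u
    have hA0 : ∀ u, 0 ≤ A u := fun u => walkSum_nonneg G hm _ _ _ _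
    have hW0 : ∀ u, 0 ≤ W u := fun u => walkCount_nonneg G hms _ _ _
    let M : V → ℝ := fun u => if 0 < r u then κ * deriv Ψ (Real.log (r u)) * A u else 0
    have hM0 : ∀ u, 0 ≤ M u := fun u => by
      simp only [M]; split_ifs
      · exact mul_nonneg (mul_nonneg hκ (hP.deriv_pos _).le) (hA0 u)
      · exact le_rfl
    have hM : ∀ u ∈ nbrs G S v, M u ^ s ≤ (c * Δ) ^ s * (δ ^ ℓ * W u) := fun u hu => by
      have hMu : M u ≤ c * Δ * (δ ^ ℓ * W u) ^ (1 / s) := by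
        simp only [M]; split_ifs with hru
        · exact ih _ _ _ (hφ.childField G hβ hγ v u) (FieldBound.forall_childField hγ hB hv hu)
            (nbrs_subset_erase G S v hu) ((hB u (mem_nbrs.1 hu).1).childField_self hv hu) hru
        · have := hW0 u
          positivity
      have h2 : 0 ≤ δ ^ ℓ * W u := mul_nonneg (pow_nonneg hδ _) (hW0 u)
      refine (Real.rpow_le_rpow (hM0 u) hMu hs0.le).trans_eq ?_
      rw [Real.mul_rpow (by positivity) (Real.rpow_nonneg h2 _), ← Real.rpow_mul h2,
        one_div_mul_cancel hs0.ne', Real.rpow_one]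
    have hcon := hP.contraction_ratio hs hδ hβ hγ hlam (nbrs G S v) (fun u _ => hr0 u)
      (fun u _ => hM0 u) (by omega : p + q + (nbrs G S v).card < Δ)
      (exp_log_regionRatio hβ hγ hφ hv hr hpq)
    have hlhs : κ * deriv Ψ (Real.log (regionRatio G β γ S φ v))
          * walkSum G β γ m (ℓ + 1 + 1) S φ v
        = deriv Ψ (Real.log (regionRatio G β γ S φ v)) * ∑ u ∈ nbrs G S v,
          |edgeInfluence β γ (r u)| / deriv Ψ (Real.log (r u)) * M u := by
      rw [mul_comm κ, mul_assoc]
      congr 1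
      rw [walkSum, Finset.mul_sum]
      refine Finset.sum_congr rfl fun u _ => ?_
      simp only [M]
      split_ifs with hru
      · have := (hP.deriv_pos (Real.log (r u))).ne'
        simp only [A, r] at this ⊢
        field_simp
      · have hru' : regionRatio G β γ (S.erase v) (childField G β γ S φ v u) u = 0 :=
          le_antisymm (not_lt.1 hru) (hr0 u)
        rw [hru']; simp [edgeInfluence]
    rw [hlhs]
    refine hcon.trans ?_
    have hsum : (∑ u ∈ nbrs G S v, M u ^ s) ^ (1 / s)
        ≤ ((c * Δ) ^ s * (δ ^ ℓ * ∑ u ∈ nbrs G S v, W u)) ^ (1 / s) := by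
      refine Real.rpow_le_rpow (Finset.sum_nonneg fun u _ => Real.rpow_nonneg (hM0 u) _) ?_
        (by positivity)
      rw [Finset.mul_sum, Finset.mul_sum]
      exact Finset.sum_le_sum hM
    have hWs : 0 ≤ ∑ u ∈ nbrs G S v, W u := Finset.sum_nonneg fun u _ => hW0 u
    have hcΔ : 0 ≤ c * Δ := by positivity
    refine (mul_le_mul_of_nonneg_left hsum (Real.rpow_nonneg hδ _)).trans_eq ?_
    rw [← Real.mul_rpow hδ (by positivity), ← mul_assoc, mul_comm δ, mul_assoc,
      Real.mul_rpow (Real.rpow_nonneg hcΔ _) (by positivity), ← Real.rpow_mul hcΔ,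
      mul_one_div_cancel hs0.ne', Real.rpow_one, walkCount, pow_succ]
    congr 2
    ring

/-- At the start of a walk, which may have `Δ` children, one uses the boundedness of the potential
instead of its contraction; this costs two factors `δ`, one at each end of the walk. The truncated
exponent `ℓ - 2` covers the walks of length less than `2`, to which no contraction applies. -/
theorem IsPotential.walkSum_root_le (hP : IsPotential s δ c Δ β γ lam Ψ) (hs : 1 ≤ s)
    (hδ : 0 ≤ δ) (hc : 0 ≤ c) (hβ : 0 ≤ β) (hγ : 0 < γ) (hlam : 0 < lam) (hΔ1 : 1 < Δ)
    (hΔ : G.maxDegree ≤ Δ) {m : V → ℝ} (hm : 0 ≤ m) {S : Finset V} {φ : V → ℤˣ → ℝ} {v : V}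
    (hφ : IsField S φ) (hB : ∀ a ∈ S, FieldBound G β γ lam S φ a Δ) (hv : v ∈ S) (ℓ : ℕ) :
    walkSum G β γ m ℓ S φ v ≤ (Δ + c * Δ * Δ)
      * (δ ^ (ℓ - 2) * walkCount G (fun a => m a ^ s) ℓ S v) ^ (1 / s) := by
  have hs0 : 0 < s := by linarith
  have hΔ1' : (1 : ℝ) < Δ := by exact_mod_cast hΔ1
  have hms : 0 ≤ fun a => m a ^ s := fun a => Real.rpow_nonneg (hm a) _
  have hcΔ : 0 ≤ c * Δ * Δ := by positivity
  have hroot : 0 ≤ (δ ^ (ℓ - 2) * walkCount G (fun a => m a ^ s) ℓ S v) ^ (1 / s) :=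
    Real.rpow_nonneg (mul_nonneg (pow_nonneg hδ _) (walkCount_nonneg G hms _ _ _)) _
  match ℓ, hroot with
  | 0, hroot =>
    refine le_trans ?_ (le_mul_of_one_le_left hroot (by linarith))
    simp only [walkSum, walkCount, Nat.zero_sub, pow_zero, one_mul]
    rw [← Real.rpow_mul (hm v), mul_one_div_cancel hs0.ne', Real.rpow_one]
  | 1, hroot =>
    refine le_trans ?_ (mul_le_mul_of_nonneg_right (le_add_of_nonneg_right hcΔ) hroot)
    simpa using walkSum_one_le hβ hγ hs0 hΔ hm hφ
  | ℓ + 2, hroot =>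
    refine le_trans ?_ (mul_le_mul_of_nonneg_right (le_add_of_nonneg_left (by linarith)) hroot)
    rw [walkSum]
    have hbound : ∀ u ∈ nbrs G S v,
        |edgeInfluence β γ (regionRatio G β γ (S.erase v) (childField G β γ S φ v u) u)|
          * walkSum G β γ m (ℓ + 1) (S.erase v) (childField G β γ S φ v u) u
        ≤ c * Δ * (δ ^ ℓ * walkCount G (fun a => m a ^ s) (ℓ + 2) S v) ^ (1 / s) := by
      intro u hu
      have hφ' := hφ.childField G hβ hγ v u
      have hmono : c * Δ * (δ ^ ℓ * walkCount G (fun a => m a ^ s) (ℓ + 1) (S.erase v) u) ^ (1 / s)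
          ≤ c * Δ * (δ ^ ℓ * walkCount G (fun a => m a ^ s) (ℓ + 2) S v) ^ (1 / s) := by
        refine mul_le_mul_of_nonneg_left (Real.rpow_le_rpow ?_ ?_ (by positivity)) (by positivity)
        · exact mul_nonneg (pow_nonneg hδ _) (walkCount_nonneg G hms _ _ _)
        · exact mul_le_mul_of_nonneg_left (Finset.single_le_sum
            (f := fun u => walkCount G (fun a => m a ^ s) (ℓ + 1) (S.erase v) u)
            (fun a _ => walkCount_nonneg G hms _ _ _) hu) (pow_nonneg hδ _)
      refine le_trans ?_ hmono
      have hnn : 0 ≤ c * Δ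
          * (δ ^ ℓ * walkCount G (fun a => m a ^ s) (ℓ + 1) (S.erase v) u) ^ (1 / s) :=
        mul_nonneg (by positivity) (Real.rpow_nonneg
          (mul_nonneg (pow_nonneg hδ _) (walkCount_nonneg G hms _ _ _)) _)
      rcases (regionRatio_nonneg G hβ hγ hφ' u).eq_or_lt with h0 | hr
      · rw [← h0]; simpa [edgeInfluence] using hnn
      rcases (nbrs G (S.erase v) u).eq_empty_or_nonempty with hemp | hne
      · rw [walkSum, hemp]; simpa using hnn
      have hb := (hB u (mem_nbrs.1 hu).1).childField_self hv hu
      have hu' := nbrs_subset_erase G S v hu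
      have hJ := log_regionRatio_mem hβ hγ hlam hΔ1 hφ' hu' hr hb hne
      have hpos := hP.deriv_pos
        (Real.log (regionRatio G β γ (S.erase v) (childField G β γ S φ v u) u))
      have := hP.walkSum_le hs hδ hc hβ hγ hlam hΔ1 hΔ hm (div_nonneg (abs_nonneg _) hpos.le)
        (fun z hz => by rw [mul_comm]; exact hP.boundedness z hz _ hJ) ℓ _ _ u hφ'
        (FieldBound.forall_childField hγ hB hv hu) hu' hb hr
      rwa [logRatioDeriv_log hr, div_mul_cancel₀ _ hpos.ne'] at this
    refine (Finset.sum_le_card_nsmul _ _ _ hbound).trans ?_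
    rw [nsmul_eq_mul]
    have : ((nbrs G S v).card : ℝ) ≤ Δ := by exact_mod_cast (card_nbrs_le G S v).trans hΔ
    have h3 : 0 ≤ c * Δ * (δ ^ ℓ * walkCount G (fun a => m a ^ s) (ℓ + 2) S v) ^ (1 / s) :=
      mul_nonneg (by positivity) hroot
    calc _ ≤ Δ * (c * Δ * (δ ^ ℓ * walkCount G (fun a => m a ^ s) (ℓ + 2) S v) ^ (1 / s)) :=
          mul_le_mul_of_nonneg_right this h3
      _ = _ := by rw [Nat.add_sub_cancel]; ring

end WalkSum

/-! ### Numbers of walks and the non-backtracking matrix -/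

section Counting

/-- Schur's test for the `0`-`1` matrix of a relation. -/
lemma sum_sq_sum_filter_le {ι κ : Type*} [Fintype ι] [Fintype κ] (R : ι → κ → Prop)
    [∀ i, DecidablePred (R i)] [∀ j, DecidablePred fun i => R i j] {a b : ℝ} (ha : 0 ≤ a)
    (hrow : ∀ i, ((Finset.univ.filter (R i)).card : ℝ) ≤ a)
    (hcol : ∀ j, ((Finset.univ.filter fun i => R i j).card : ℝ) ≤ b) (x : κ → ℝ) :
    ∑ i, (∑ j ∈ Finset.univ.filter (R i), x j) ^ 2 ≤ a * b * ∑ j, x j ^ 2 := by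
  calc ∑ i, (∑ j ∈ Finset.univ.filter (R i), x j) ^ 2
      ≤ ∑ i, a * ∑ j ∈ Finset.univ.filter (R i), x j ^ 2 := Finset.sum_le_sum fun i _ =>
        sq_sum_le_card_mul_sum_sq.trans (mul_le_mul_of_nonneg_right (hrow i)
          (Finset.sum_nonneg fun j _ => sq_nonneg _))
    _ = a * ∑ j, ((Finset.univ.filter fun i => R i j).card : ℝ) * x j ^ 2 := by
        rw [← Finset.mul_sum]
        congr 1
        simp_rw [Finset.sum_filter]
        rw [Finset.sum_comm]
        refine Finset.sum_congr rfl fun j _ => ?_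
        rw [← Finset.sum_filter, Finset.sum_const, nsmul_eq_mul]
    _ ≤ a * ∑ j, b * x j ^ 2 := mul_le_mul_of_nonneg_left
        (Finset.sum_le_sum fun j _ => mul_le_mul_of_nonneg_right (hcol j) (sq_nonneg _)) ha
    _ = _ := by rw [← Finset.mul_sum, mul_assoc]

lemma sum_le_sum_of_injOn {ι κ : Type*} [DecidableEq κ] {s : Finset ι} {t : Finset κ} {f : ι → ℝ}
    {g : κ → ℝ} (e : ι → κ) (hmem : ∀ i ∈ s, e i ∈ t) (hinj : Set.InjOn e s)
    (hle : ∀ i ∈ s, f i ≤ g (e i)) (hg : ∀ j ∈ t, 0 ≤ g j) : ∑ i ∈ s, f i ≤ ∑ j ∈ t, g j := by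
  refine (Finset.sum_le_sum hle).trans ?_
  rw [← Finset.sum_image (f := g) hinj]
  exact Finset.sum_le_sum_of_subset_of_nonneg (Finset.image_subset_iff.2 hmem) fun j hj _ => hg j hj

section SAWalk

variable {V : Type*} {G : SimpleGraph V}

/-- The walk without its last vertex. -/
def SAWalk.init {k : ℕ} (P : SAWalk G (k + 1)) : SAWalk G k :=
  ⟨fun i => P.1 i.castSucc, fun _ _ h => Fin.castSucc_injective _ (P.2.1 h),
    fun i => P.2.2 i.castSucc⟩

/-- The walk without its first vertex. -/
def SAWalk.tail {k : ℕ} (P : SAWalk G (k + 1)) : SAWalk G k :=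
  ⟨fun i => P.1 i.succ, fun _ _ h => Fin.succ_injective _ (P.2.1 h), fun i => P.2.2 i.succ⟩

lemma SAWalk.exists_init_eq {k : ℕ} (P : SAWalk G k) {u : V} (hu : G.Adj (P.1 (Fin.last k)) u)
    (hP : ∀ t, P.1 t ≠ u) : ∃ Q : SAWalk G (k + 1), Q.init = P ∧ Q.1 (Fin.last (k + 1)) = u := by
  refine ⟨⟨Fin.snoc (α := fun _ => V) P.1 u, ?_, ?_⟩, ?_, ?_⟩
  · rw [Fin.snoc_injective_iff]
    exact ⟨P.2.1, fun ⟨t, ht⟩ => hP t ht⟩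
  · intro i
    induction i using Fin.lastCases with
    | last => simpa using hu
    | cast i =>
      rw [Fin.succ_castSucc, Fin.snoc_castSucc, Fin.snoc_castSucc]
      exact P.2.2 i
  · exact Subtype.ext (funext fun i => by simp [SAWalk.init])
  · simp

lemma SAWalk.ext_init {k : ℕ} {P Q : SAWalk G (k + 1)} (h : P.init = Q.init)
    (hl : P.1 (Fin.last _) = Q.1 (Fin.last _)) : P = Q := by
  refine Subtype.ext (funext fun i => ?_)
  induction i using Fin.lastCases with
  | last => exact hl
  | cast i => exact congrFun (congrArg Subtype.val h) i

lemma SAWalk.ext_tail {k : ℕ} {P Q : SAWalk G (k + 1)} (h : P.tail = Q.tail)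
    (h0 : P.1 0 = Q.1 0) : P = Q := by
  refine Subtype.ext (funext fun i => ?_)
  induction i using Fin.cases with
  | zero => exact h0
  | succ i => exact congrFun (congrArg Subtype.val h) i

variable [Fintype V] [DecidableEq V] [DecidableRel G.Adj] {Δ : ℕ}

lemma card_le_of_injOn_adj (hΔ : G.maxDegree ≤ Δ) {ι : Type*} {s : Finset ι} (e : ι → V) (v : V)
    (hmem : ∀ i ∈ s, G.Adj v (e i)) (hinj : Set.InjOn e s) : s.card ≤ Δ := by
  refine (Finset.card_le_card_of_injOn e (t := G.neighborFinset v) (fun i hi => ?_) hinj).trans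
    ((G.degree_le_maxDegree v).trans hΔ)
  simpa using hmem i hi

lemma card_walks_from_le (hΔ : G.maxDegree ≤ Δ) (w : V) (k : ℕ) :
    (Finset.univ.filter fun P : SAWalk G k => P.1 0 = w).card ≤ Δ ^ k := by
  induction k with
  | zero =>
    rw [pow_zero, Finset.card_le_one]
    intro P hP Q hQ
    simp only [Finset.mem_filter, Finset.mem_univ, true_and] at hP hQ
    refine Subtype.ext (funext fun i => ?_)
    rw [Fin.fin_one_eq_zero i, hP, hQ]
  | succ k ih =>
    rw [pow_succ']
    refine (Finset.card_le_mul_card_image_of_maps_to (f := SAWalk.init)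
      (t := Finset.univ.filter fun P : SAWalk G k => P.1 0 = w) ?_ Δ ?_).trans
      (Nat.mul_le_mul_left Δ ih)
    · intro P hP
      exact Finset.mem_filter.2 ⟨Finset.mem_univ _, (Finset.mem_filter.1 hP).2⟩
    · intro P _
      refine card_le_of_injOn_adj hΔ (fun Q : SAWalk G (k + 1) => Q.1 (Fin.last _))
        (P.1 (Fin.last _)) (fun Q hQ => ?_) fun Q hQ Q' hQ' h => ?_
      · rw [← (Finset.mem_filter.1 hQ).2]
        exact Q.2.2 (Fin.last _)
      · exact SAWalk.ext_init ((Finset.mem_filter.1 hQ).2.trans (Finset.mem_filter.1 hQ').2.symm) h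

lemma card_walks_to_le (hΔ : G.maxDegree ≤ Δ) (w : V) (k : ℕ) :
    (Finset.univ.filter fun P : SAWalk G k => P.1 (Fin.last k) = w).card ≤ Δ ^ k := by
  induction k with
  | zero =>
    rw [pow_zero, Finset.card_le_one]
    intro P hP Q hQ
    simp only [Finset.mem_filter, Finset.mem_univ, true_and] at hP hQ
    refine Subtype.ext (funext fun i => ?_)
    rw [Fin.fin_one_eq_zero i]
    exact hP.trans hQ.symm
  | succ k ih =>
    rw [pow_succ']
    refine (Finset.card_le_mul_card_image_of_maps_to (f := SAWalk.tail)
      (t := Finset.univ.filter fun P : SAWalk G k => P.1 (Fin.last k) = w) ?_ Δ ?_).trans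
      (Nat.mul_le_mul_left Δ ih)
    · intro P hP
      exact Finset.mem_filter.2 ⟨Finset.mem_univ _, (Finset.mem_filter.1 hP).2⟩
    · intro P _
      refine card_le_of_injOn_adj hΔ (fun Q : SAWalk G (k + 1) => Q.1 0)
        (P.1 0) (fun Q hQ => ?_) fun Q hQ Q' hQ' h => ?_
      · rw [← (Finset.mem_filter.1 hQ).2]
        exact (Q.2.2 0).symm
      · exact SAWalk.ext_tail ((Finset.mem_filter.1 hQ).2.trans (Finset.mem_filter.1 hQ').2.symm) h

/-- The relation whose indicator is the `k`-non-backtracking matrix. -/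
def NonBacktracking {k : ℕ} (P Q : SAWalk G k) : Prop :=
  P.1 0 ≠ Q.1 (Fin.last k) ∧ ∀ i : Fin k, Q.1 i.castSucc = P.1 i.succ

omit [DecidableEq V] [DecidableRel G.Adj] in
open Classical in
lemma nonBacktrackingMatrix_mulVec {k : ℕ} (x : SAWalk G k → ℝ) (P : SAWalk G k) :
    (nonBacktrackingMatrix G k).mulVec x P
      = ∑ Q ∈ Finset.univ.filter (NonBacktracking P), x Q := by
  rw [Finset.sum_filter]
  refine Finset.sum_congr rfl fun Q _ => ?_
  by_cases h : NonBacktracking P Q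
  · rw [if_pos h]
    exact (congrArg (· * x Q) (if_pos h)).trans (one_mul _)
  · rw [if_neg h]
    exact (congrArg (· * x Q) (if_neg h)).trans (zero_mul _)

open Classical in
lemma card_nonBacktracking_le (hΔ : G.maxDegree ≤ Δ) {k : ℕ} (hk : 1 ≤ k) (P : SAWalk G k) :
    (Finset.univ.filter (NonBacktracking P)).card ≤ Δ := by
  obtain ⟨k, rfl⟩ := Nat.exists_eq_add_of_le' hk
  refine card_le_of_injOn_adj hΔ (fun Q : SAWalk G (k + 1) => Q.1 (Fin.last _))
    (P.1 (Fin.last _)) (fun Q hQ => ?_) fun Q hQ Q' hQ' h => ?_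
  · have h := (Finset.mem_filter.1 hQ).2.2 (Fin.last k)
    rw [Fin.succ_last] at h
    rw [← h]
    exact Q.2.2 (Fin.last _)
  · exact SAWalk.ext_init (Subtype.ext (funext fun i =>
      ((Finset.mem_filter.1 hQ).2.2 i).trans ((Finset.mem_filter.1 hQ').2.2 i).symm)) h

open Classical in
lemma card_nonBacktracking_le' (hΔ : G.maxDegree ≤ Δ) {k : ℕ} (hk : 1 ≤ k) (Q : SAWalk G k) :
    (Finset.univ.filter fun P => NonBacktracking P Q).card ≤ Δ := by
  obtain ⟨k, rfl⟩ := Nat.exists_eq_add_of_le' hk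
  refine card_le_of_injOn_adj hΔ (fun P : SAWalk G (k + 1) => P.1 0)
    (Q.1 0) (fun P hP => ?_) fun P hP P' hP' h => ?_
  · have h := (Finset.mem_filter.1 hP).2.2 0
    rw [Fin.castSucc_zero] at h
    rw [h]
    exact (P.2.2 0).symm
  · exact SAWalk.ext_tail (Subtype.ext (funext fun i =>
      ((Finset.mem_filter.1 hP).2.2 i).symm.trans ((Finset.mem_filter.1 hP').2.2 i))) h

end SAWalk

section Norm

variable {ι : Type*} [Fintype ι] [DecidableEq ι]

lemma sum_sq_mulVec_le (M : Matrix ι ι ℝ) (x : ι → ℝ) :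
    ∑ i, M.mulVec x i ^ 2 ≤ l2Norm M ^ 2 * ∑ i, x i ^ 2 := by
  have h := (Matrix.toEuclideanCLM (n := ι) (𝕜 := ℝ) M).le_opNorm (WithLp.toLp 2 x)
  have h2 := pow_le_pow_left₀ (norm_nonneg _) h 2
  rw [mul_pow, EuclideanSpace.norm_sq_eq, EuclideanSpace.norm_sq_eq,
    Matrix.ofLp_toEuclideanCLM] at h2
  simp only [Real.norm_eq_abs, sq_abs] at h2
  exact h2

lemma l2Norm_le {M : Matrix ι ι ℝ} {a : ℝ} (ha : 0 ≤ a)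
    (h : ∀ x : ι → ℝ, ∑ i, M.mulVec x i ^ 2 ≤ a ^ 2 * ∑ i, x i ^ 2) : l2Norm M ≤ a := by
  refine ContinuousLinearMap.opNorm_le_bound _ ha fun x => ?_
  refine le_of_sq_le_sq ?_ (by positivity)
  rw [mul_pow, EuclideanSpace.norm_sq_eq, EuclideanSpace.norm_sq_eq, Matrix.ofLp_toEuclideanCLM]
  simpa only [Real.norm_eq_abs, sq_abs] using h x.ofLp

lemma l2Norm_nonneg (M : Matrix ι ι ℝ) : 0 ≤ l2Norm M := norm_nonneg _

lemma l2Norm_mul_le (M M' : Matrix ι ι ℝ) : l2Norm (M * M') ≤ l2Norm M * l2Norm M' := by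
  unfold l2Norm
  rw [map_mul]
  exact norm_mul_le _ _

lemma l2Norm_pow_le {M : Matrix ι ι ℝ} {a : ℝ} (h : l2Norm M ≤ a) (j : ℕ) :
    l2Norm (M ^ j) ≤ a ^ j := by
  have ha := (l2Norm_nonneg M).trans h
  induction j with
  | zero => exact l2Norm_le (by simp) fun x => by simp
  | succ j ih =>
    rw [pow_succ, pow_succ]
    exact (l2Norm_mul_le _ _).trans (mul_le_mul ih h (l2Norm_nonneg _) (by positivity))

end Norm

variable {V : Type*} [Fintype V] [DecidableEq V] {G : SimpleGraph V} [DecidableRel G.Adj] {Δ : ℕ}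

lemma l2Norm_nonBacktrackingMatrix_le (hΔ : G.maxDegree ≤ Δ) {k : ℕ} (hk : 1 ≤ k) :
    l2Norm (nonBacktrackingMatrix G k) ≤ Δ := by
  classical
  refine l2Norm_le (Nat.cast_nonneg _) fun x => ?_
  simp_rw [nonBacktrackingMatrix_mulVec]
  rw [sq]
  exact sum_sq_sum_filter_le NonBacktracking (Nat.cast_nonneg _)
    (fun P => by exact_mod_cast card_nonBacktracking_le hΔ hk P)
    (fun Q => by exact_mod_cast card_nonBacktracking_le' hΔ hk Q) x

/-- The norms of the powers of the non-backtracking matrix grow at the rate `ρ` determined by its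
`N`-th power. -/
lemma l2Norm_nonBacktrackingMatrix_pow_le (hΔ : G.maxDegree ≤ Δ) (hΔ1 : 1 ≤ Δ) {k N : ℕ}
    (hk : 1 ≤ k) (hN : 1 ≤ N) {ρ : ℝ} (hρ : 1 ≤ ρ)
    (h : l2Norm (nonBacktrackingMatrix G k ^ N) ≤ ρ ^ N) (j : ℕ) :
    l2Norm (nonBacktrackingMatrix G k ^ j) ≤ Δ ^ N * ρ ^ j := by
  have hΔ1' : (1 : ℝ) ≤ Δ := by exact_mod_cast hΔ1
  rw [← Nat.mod_add_div j N, pow_add, pow_mul]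
  refine (l2Norm_mul_le _ _).trans (mul_le_mul ?_ ?_ (l2Norm_nonneg _) (by positivity))
  · exact (l2Norm_pow_le (l2Norm_nonBacktrackingMatrix_le hΔ hk) _).trans
      (pow_le_pow_right₀ hΔ1' (Nat.mod_lt _ hN).le)
  · refine (l2Norm_pow_le h _).trans ?_
    rw [← pow_mul]
    exact pow_le_pow_right₀ hρ (Nat.le_add_left _ _)

/-- A self-avoiding walk that continues `P` by `j` steps is a non-backtracking walk on windows of
length `k`. -/
lemma walkCount_le_nonBacktrackingMatrix {k : ℕ} {f : V → ℝ} (hf : 0 ≤ f) (j : ℕ) :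
    ∀ (S : Finset V) (P : SAWalk G k), P.1 (Fin.last k) ∈ S → (∀ i : Fin k, P.1 i.castSucc ∉ S) →
      walkCount G f j S (P.1 (Fin.last k))
        ≤ (nonBacktrackingMatrix G k ^ j).mulVec (fun Q => f (Q.1 (Fin.last k))) P := by
  have hnn : ∀ (j : ℕ) (P : SAWalk G k),
      0 ≤ (nonBacktrackingMatrix G k ^ j).mulVec (fun Q => f (Q.1 (Fin.last k))) P := by
    classical
    intro j
    induction j with
    | zero => intro P; simpa using hf _
    | succ j ih =>
      intro P
      rw [pow_succ', ← Matrix.mulVec_mulVec, nonBacktrackingMatrix_mulVec]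
      exact Finset.sum_nonneg fun Q _ => ih Q
  induction j with
  | zero => intro S P _ _; simp [walkCount]
  | succ j ih =>
    classical
    intro S P hPS hP
    rw [pow_succ', ← Matrix.mulVec_mulVec, nonBacktrackingMatrix_mulVec, walkCount]
    have hne : ∀ u ∈ nbrs G S (P.1 (Fin.last k)), ∀ t, P.1 t ≠ u := by
      rintro u hu t rfl
      rw [mem_nbrs] at hu
      induction t using Fin.lastCases with
      | last => exact hu.2.ne rfl
      | cast t => exact hP t hu.1
    have hex : ∀ u, ∃ Q : SAWalk G k, u ∈ nbrs G S (P.1 (Fin.last k)) →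
        NonBacktracking P Q ∧ Q.1 (Fin.last k) = u := by
      intro u
      by_cases hu : u ∈ nbrs G S (P.1 (Fin.last k))
      · obtain ⟨Q, hQP, hQu⟩ := P.exists_init_eq (mem_nbrs.1 hu).2 (hne u hu)
        refine ⟨Q.tail, fun _ => ⟨⟨?_, fun i => ?_⟩, hQu⟩⟩
        · exact fun h => hne u hu 0 (h.trans hQu)
        · rw [← hQP]
          rfl
      · exact ⟨P, fun h => absurd h hu⟩
    choose e he using hex
    refine sum_le_sum_of_injOn e (fun u hu => by simpa using (he u hu).1)
      (fun u hu u' hu' h => ?_) (fun u hu => ?_) fun Q _ => hnn j Q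
    · rw [← (he u hu).2, h, (he u' hu').2]
    · have h1 := ih (S.erase (P.1 (Fin.last k))) (e u) (by
        rw [(he u hu).2]; exact nbrs_subset_erase G S _ hu) (fun i => by
        rw [(he u hu).1.2 i]
        intro hmem
        obtain ⟨h2, h3⟩ := Finset.mem_erase.1 hmem
        obtain hi | ⟨i', hi'⟩ := Fin.eq_castSucc_or_eq_last i.succ |>.symm
        · exact h2 (by rw [hi])
        · rw [hi'] at h3; exact hP i' h3)
      rwa [(he u hu).2] at h1

/-- The vertices not visited by `P` before its end. -/
def SAWalk.remaining {k : ℕ} (P : SAWalk G k) : Finset V :=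
  Finset.univ.filter fun a => ∀ t : Fin k, P.1 t.castSucc ≠ a

/-- Splitting walks after their first `i` steps. -/
lemma walkCount_add_le {f : V → ℝ} (hf : 0 ≤ f) (w : V) (i : ℕ) : ∀ j : ℕ,
    walkCount G f (i + j) Finset.univ w ≤ ∑ P ∈ Finset.univ.filter fun P : SAWalk G i => P.1 0 = w,
      walkCount G f j P.remaining (P.1 (Fin.last i)) := by
  classical
  induction i with
  | zero =>
    intro j
    let P : SAWalk G 0 := ⟨fun _ => w, fun a b _ => Subsingleton.elim (α := Fin 1) a b, fun i => i.elim0⟩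
    have hP : P.remaining = Finset.univ := by
      ext a; simp [SAWalk.remaining]
    have := Finset.single_le_sum (f := fun P : SAWalk G 0 =>
      walkCount G f j P.remaining (P.1 (Fin.last 0)))
      (fun Q _ => walkCount_nonneg G hf j _ _)
      (show P ∈ Finset.univ.filter fun P : SAWalk G 0 => P.1 0 = w from
        Finset.mem_filter.2 ⟨Finset.mem_univ _, rfl⟩)
    simpa only [zero_add, hP] using this
  | succ i ih =>
    intro j
    rw [show i + 1 + j = i + (j + 1) by ring]
    refine (ih (j + 1)).trans ?_
    have hmaps : ∀ P ∈ Finset.univ.filter (fun P : SAWalk G (i + 1) => P.1 0 = w),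
        P.init ∈ Finset.univ.filter (fun P : SAWalk G i => P.1 0 = w) := fun P hP =>
      Finset.mem_filter.2 ⟨Finset.mem_univ _, (Finset.mem_filter.1 hP).2⟩
    rw [← Finset.sum_fiberwise_of_maps_to hmaps]
    refine Finset.sum_le_sum fun P hP => ?_
    rw [walkCount]
    have hrem : P.1 (Fin.last i) ∈ P.remaining := by
      simp only [SAWalk.remaining, Finset.mem_filter, Finset.mem_univ, true_and]
      intro t h
      exact (Fin.castSucc_lt_last t).ne (P.2.1 h)
    have hne : ∀ u ∈ nbrs G P.remaining (P.1 (Fin.last i)), ∀ t, P.1 t ≠ u := by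
      rintro u hu t rfl
      rw [mem_nbrs] at hu
      induction t using Fin.lastCases with
      | last => exact hu.2.ne rfl
      | cast t => exact (Finset.mem_filter.1 hu.1).2 t rfl
    rcases (nbrs G P.remaining (P.1 (Fin.last i))).eq_empty_or_nonempty with h0 | ⟨u₀, hu₀⟩
    · rw [h0, Finset.sum_empty]
      exact Finset.sum_nonneg fun Q _ => walkCount_nonneg G hf _ _ _
    obtain ⟨Q₀, -⟩ := P.exists_init_eq (mem_nbrs.1 hu₀).2 (hne u₀ hu₀)
    have hex : ∀ u, ∃ Q : SAWalk G (i + 1), u ∈ nbrs G P.remaining (P.1 (Fin.last i)) →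
        Q.init = P ∧ Q.1 (Fin.last _) = u := by
      intro u
      by_cases hu : u ∈ nbrs G P.remaining (P.1 (Fin.last i))
      · obtain ⟨Q, hQ⟩ := P.exists_init_eq (mem_nbrs.1 hu).2 (hne u hu)
        exact ⟨Q, fun _ => hQ⟩
      · exact ⟨Q₀, fun h => absurd h hu⟩
    choose e he using hex
    refine sum_le_sum_of_injOn e (fun u hu => ?_) (fun u hu u' hu' h => ?_) (fun u hu => ?_)
      fun Q _ => walkCount_nonneg G hf _ _ _
    · simp only [Finset.mem_filter, Finset.mem_univ, true_and]
      refine ⟨?_, (he u hu).1⟩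
      rw [← (Finset.mem_filter.1 hP).2, ← (he u hu).1]
      rfl
    · rw [← (he u hu).2, h, (he u' hu').2]
    · have hr : (e u).remaining = P.remaining.erase (P.1 (Fin.last i)) := by
        obtain ⟨hQ, -⟩ := he u hu
        ext a
        simp only [SAWalk.remaining, Finset.mem_filter, Finset.mem_univ, true_and,
          Finset.mem_erase, Fin.forall_fin_succ', ← hQ]
        simp only [SAWalk.init, ne_comm (a := a), and_comm]
      rw [hr, (he u hu).2]

lemma sum_sq_walkCount_le_pow (hΔ : G.maxDegree ≤ Δ) {f : V → ℝ} (hf : 0 ≤ f) (ℓ : ℕ) :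
    ∑ w, walkCount G f ℓ Finset.univ w ^ 2 ≤ ((Δ : ℝ) ^ ℓ) ^ 2 * ∑ w, f w ^ 2 := by
  induction ℓ with
  | zero => simp [walkCount]
  | succ ℓ ih =>
    have hcard : ∀ w, ((Finset.univ.filter (G.Adj w)).card : ℝ) ≤ Δ := fun w => by
      exact_mod_cast (card_nbrs_le G Finset.univ w).trans hΔ
    calc ∑ w, walkCount G f (ℓ + 1) Finset.univ w ^ 2
        ≤ ∑ w, (∑ u ∈ Finset.univ.filter (G.Adj w), walkCount G f ℓ Finset.univ u) ^ 2 :=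
          Finset.sum_le_sum fun w _ => pow_le_pow_left₀ (walkCount_nonneg G hf _ _ _)
            (Finset.sum_le_sum fun u _ => walkCount_mono G hf ℓ (Finset.subset_univ _) u) 2
      _ ≤ Δ * Δ * ∑ w, walkCount G f ℓ Finset.univ w ^ 2 :=
          sum_sq_sum_filter_le G.Adj (Nat.cast_nonneg _) hcard
            (fun u => by simpa only [G.adj_comm _ u] using hcard u) _
      _ ≤ Δ * Δ * (((Δ : ℝ) ^ ℓ) ^ 2 * ∑ w, f w ^ 2) := by gcongr
      _ = _ := by ring

/-- The number of self-avoiding walks of length `ℓ` between two vertices, as a matrix, has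
Euclidean norm of order `ρ ^ ℓ`. -/
theorem sum_sq_walkCount_le (hΔ : G.maxDegree ≤ Δ) (hΔ1 : 1 ≤ Δ) {k N : ℕ}
    (hk : 1 ≤ k) (hN : 1 ≤ N) {ρ : ℝ} (hρ : 1 ≤ ρ)
    (h : l2Norm (nonBacktrackingMatrix G k ^ N) ≤ ρ ^ N) {f : V → ℝ} (hf : 0 ≤ f) (ℓ : ℕ) :
    ∑ w, walkCount G f ℓ Finset.univ w ^ 2 ≤ ((Δ : ℝ) ^ (k + N) * ρ ^ ℓ) ^ 2 * ∑ w, f w ^ 2 := by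
  classical
  have hΔ1' : (1 : ℝ) ≤ Δ := by exact_mod_cast hΔ1
  have hf2 : 0 ≤ ∑ w, f w ^ 2 := Finset.sum_nonneg fun w _ => sq_nonneg _
  rcases lt_or_ge ℓ k with hℓ | hℓ
  · refine (sum_sq_walkCount_le_pow hΔ hf ℓ).trans (mul_le_mul_of_nonneg_right
      (pow_le_pow_left₀ (by positivity) ?_ 2) hf2)
    calc (Δ : ℝ) ^ ℓ ≤ Δ ^ (k + N) := pow_le_pow_right₀ hΔ1' (by omega)
      _ ≤ _ := le_mul_of_one_le_right (by positivity) (one_le_pow₀ hρ)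
  · obtain ⟨j, rfl⟩ := Nat.exists_eq_add_of_le hℓ
    set F : SAWalk G k → ℝ := fun Q => f (Q.1 (Fin.last k)) with hF
    set H := nonBacktrackingMatrix G k
    calc ∑ w, walkCount G f (k + j) Finset.univ w ^ 2
        ≤ ∑ w, (∑ P ∈ Finset.univ.filter fun P : SAWalk G k => P.1 0 = w,
            (H ^ j).mulVec F P) ^ 2 := by
          refine Finset.sum_le_sum fun w _ => pow_le_pow_left₀ (walkCount_nonneg G hf _ _ _)
            ((walkCount_add_le hf w k j).trans (Finset.sum_le_sum fun P _ => ?_)) 2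
          refine walkCount_le_nonBacktrackingMatrix hf j _ P ?_ fun i => ?_
          · simp only [SAWalk.remaining, Finset.mem_filter, Finset.mem_univ, true_and]
            exact fun t ht => (Fin.castSucc_lt_last t).ne (P.2.1 ht)
          · simp only [SAWalk.remaining, Finset.mem_filter, Finset.mem_univ, true_and]
            exact fun hi => hi i rfl
      _ ≤ Δ ^ k * 1 * ∑ P, (H ^ j).mulVec F P ^ 2 :=
          sum_sq_sum_filter_le (fun (w : V) (P : SAWalk G k) => P.1 0 = w) (by positivity)
            (fun w => by exact_mod_cast card_walks_from_le hΔ w k) (fun P => by simp [Finset.filter_eq]) _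
      _ ≤ Δ ^ k * 1 * ((Δ ^ N * ρ ^ j) ^ 2 * ∑ P, F P ^ 2) := by
          refine mul_le_mul_of_nonneg_left ((sum_sq_mulVec_le _ _).trans ?_) (by positivity)
          refine mul_le_mul_of_nonneg_right (pow_le_pow_left₀ (l2Norm_nonneg _)
            (l2Norm_nonBacktrackingMatrix_pow_le hΔ hΔ1 hk hN hρ h j) 2)
            (Finset.sum_nonneg fun w _ => sq_nonneg _)
      _ ≤ Δ ^ k * 1 * ((Δ ^ N * ρ ^ j) ^ 2 * (1 * Δ ^ k * ∑ w, f w ^ 2)) := by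
          have hend := sum_sq_sum_filter_le (fun (P : SAWalk G k) (w : V) => P.1 (Fin.last k) = w)
            (a := 1) (b := (Δ : ℝ) ^ k) zero_le_one (fun P => by simp [Finset.filter_eq])
            (fun w => by exact_mod_cast card_walks_to_le hΔ w k) f
          simp only [Finset.filter_eq, Finset.mem_univ, if_true, Finset.sum_singleton] at hend
          gcongr
      _ = (Δ ^ (k + N) * ρ ^ j) ^ 2 * ∑ w, f w ^ 2 := by ring
      _ ≤ _ := by
          refine mul_le_mul_of_nonneg_right (pow_le_pow_left₀ (by positivity) ?_ 2) hf2
          exact mul_le_mul_of_nonneg_left (pow_le_pow_right₀ hρ (Nat.le_add_left _ _))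
            (by positivity)

end Counting

/-! ### Pinnings of the Gibbs distribution -/

section Gibbs

variable {V : Type*} [Fintype V] [DecidableEq V] (G : SimpleGraph V) [DecidableRel G.Adj]
  {β γ lam : ℝ}

/-- The fields of the Gibbs distribution before any vertex is pinned. -/
def freeField (lam : ℝ) : V → ℤˣ → ℝ := fun _ x => if x = 1 then lam else 1

lemma weight_eq_regionWeight (β γ lam : ℝ) (σ : Config V) :
    weight G β γ lam σ = regionWeight G β γ Finset.univ (freeField lam) σ := by
  unfold weight regionWeight freeField
  rw [← Finset.prod_const, ← Finset.prod_const, ← Finset.prod_const, Finset.prod_filter,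
    Finset.prod_filter, Finset.prod_filter, mul_assoc, ← Finset.prod_mul_distrib,
    Finset.filter_true_of_mem fun _ _ _ _ => Finset.mem_univ _]
  congr 1
  refine Finset.prod_congr rfl fun e _ => ?_
  induction e with | _ a b => ?_
  simp only [Sym2.mem_iff, forall_eq_or_imp, forall_eq, pairFactor, Sym2.lift_mk, edgeFactor]
  have hne : (-1 : ℤˣ) ≠ 1 := by decide
  have hne' : (1 : ℤˣ) ≠ -1 := by decide
  rcases Int.units_eq_one_or (σ a) with h | h <;> rcases Int.units_eq_one_or (σ b) with h' | h' <;>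
    simp [h, h', hne, hne']

lemma isField_freeField (hlam : 0 < lam) (S : Finset V) :
    IsField S (freeField lam : V → ℤˣ → ℝ) := by
  refine ⟨fun a _ x => ?_, fun a _ => ?_⟩ <;> unfold freeField <;> split_ifs <;> positivity

/-- Pinning the vertices of `Λ` leaves, up to a constant, the weight on the complement of `Λ` with
fields that have absorbed the edges to `Λ`. -/
lemma exists_field_of_pinned (hβ : 0 ≤ β) (hγ : 0 < γ) (hlam : 0 < lam) (τ : V → ℤˣ)
    (Λ : Finset V) : ∃ (φ : V → ℤˣ → ℝ) (C : ℝ), 0 ≤ C ∧ IsField Λᶜ φ ∧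
      (∀ a ∈ Λᶜ, FieldBound G β γ lam Λᶜ φ a G.maxDegree) ∧
      ∀ f : Config V → ℝ, (∀ a ∈ Λ, IgnoresSpin f a) →
        ∑ σ, (if ∀ v ∈ Λ, σ v = τ v then weight G β γ lam σ * f σ else 0)
          = C * mass (regionWeight G β γ Λᶜ φ * f) := by
  induction Λ using Finset.induction_on with
  | empty =>
    refine ⟨freeField lam, 1, zero_le_one, isField_freeField hlam _, fun a _ => ⟨0, 0, ?_, ?_⟩,
      fun f _ => ?_⟩
    · simp [freeField, show (-1 : ℤˣ) ≠ 1 by decide]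
    · simpa using card_nbrs_le G _ a
    · simp [mass, weight_eq_regionWeight]
  | insert a Λ ha ih =>
    obtain ⟨φ, C, hC, hφ, hB, hsum⟩ := ih
    have haΛ : a ∈ Λᶜ := Finset.mem_compl.2 ha
    rw [Finset.compl_insert]
    set φ' : V → ℤˣ → ℝ := fun b x =>
      if b ∈ nbrs G Λᶜ a then φ b x * edgeFactor β γ (τ a) x else φ b x with hφ'
    refine ⟨φ', C * φ a (τ a) / 2, ?_, ⟨fun b hb x => ?_, fun b hb => ?_⟩, fun b hb => ?_,
      fun f hf => ?_⟩
    · have := hφ.nonneg a haΛ (τ a)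
      positivity
    · simp only [hφ']
      have := (hφ.erase a).nonneg b hb x
      split_ifs
      · exact mul_nonneg this (edgeFactor_nonneg hβ hγ _ _)
      · exact this
    · simp only [hφ']
      have := (hφ.erase a).pos b hb
      split_ifs
      · exact mul_pos this (edgeFactor_neg_one_pos hγ _)
      · exact this
    · refine (hB b (Finset.mem_of_mem_erase hb)).absorb hγ haΛ (y := τ a) fun x => ?_
      simp only [hφ', mem_nbrs, Finset.mem_of_mem_erase hb, true_and]
    · have h1 := hsum (fun σ => if σ a = τ a then f σ else 0) fun b hb σ x => by
        simp only [hf b (Finset.mem_insert_of_mem hb) σ x,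
          Function.update_of_ne (ne_of_mem_of_not_mem hb ha).symm]
      have h2 : mass (regionWeight G β γ Λᶜ φ * fun σ => if σ a = τ a then f σ else 0)
          = spinMass (regionWeight G β γ Λᶜ φ * f) a (τ a) := by
        refine Finset.sum_congr rfl fun σ _ => ?_
        simp only [Pi.mul_apply, mul_ite, mul_zero]
      have h3 := spinMass_regionWeight G β γ haΛ φ (hf a (Finset.mem_insert_self _ _)) (τ a)
      rw [attach_regionWeight G β γ (nbrs_subset_erase G Λᶜ a)] at h3
      calc _ = ∑ σ, (if ∀ v ∈ Λ, σ v = τ v then weight G β γ lam σ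
              * (if σ a = τ a then f σ else 0) else 0) := by
            refine Finset.sum_congr rfl fun σ _ => ?_
            simp only [Finset.forall_mem_insert]
            by_cases h : σ a = τ a <;> simp [h]
        _ = C * (2 * spinMass (regionWeight G β γ Λᶜ φ * f) a (τ a)) / 2 := by
            rw [h1, h2]; ring
        _ = _ := by rw [h3]; ring

lemma prob_gibbs (A : Set (Config V)) [DecidablePred (· ∈ A)] :
    prob (gibbs G β γ lam) A
      = (∑ σ, if σ ∈ A then weight G β γ lam σ else 0) / partitionFunction G β γ lam := by
  unfold prob
  rw [Finset.sum_div]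
  refine Finset.sum_congr rfl fun σ _ => ?_
  by_cases h : σ ∈ A <;> simp [h, gibbs]

lemma partitionFunction_pos (hβ : 0 ≤ β) (hγ : 0 < γ) (hlam : 0 < lam) :
    0 < partitionFunction G β γ lam := by
  unfold partitionFunction
  simp only [weight_eq_regionWeight]
  have hφ := isField_freeField hlam (Finset.univ : Finset V)
  exact Finset.sum_pos' (fun σ _ => regionWeight_nonneg G hβ hγ hφ σ)
    ⟨_, Finset.mem_univ _, regionWeight_neg_one_pos G hγ hφ⟩

/-- The nonzero entries of the influence matrix are influences in the region of the unpinned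
vertices. -/
lemma influenceMatrix_eq (hβ : 0 ≤ β) (hγ : 0 < γ) (hlam : 0 < lam) (Λ : Finset V)
    (τ : Λ → ℤˣ) : ∃ φ : V → ℤˣ → ℝ, IsField Λᶜ φ ∧
      (∀ a ∈ Λᶜ, FieldBound G β γ lam Λᶜ φ a G.maxDegree) ∧
      ∀ w u : {v : V // v ∉ Λ}, influenceMatrix (gibbs G β γ lam) Λ τ w u = 0 ∨
        0 < regionRatio G β γ Λᶜ φ w ∧
          influenceMatrix (gibbs G β γ lam) Λ τ w u = regionInfluence G β γ Λᶜ φ w u := by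
  classical
  obtain ⟨φ, C, hC, hφ, hB, hsum⟩ := exists_field_of_pinned G hβ hγ hlam
    (fun v => if h : v ∈ Λ then τ ⟨v, h⟩ else 1) Λ
  refine ⟨φ, hφ, hB, fun w u => ?_⟩
  set F := regionWeight G β γ Λᶜ φ with hF
  have hFnn := regionWeight_nonneg G hβ hγ hφ
  have hZ := (partitionFunction_pos G hβ hγ hlam).ne'
  have hpin : ∀ σ : Config V, σ ∈ pinned Λ τ ↔
      ∀ v ∈ Λ, σ v = (if h : v ∈ Λ then τ ⟨v, h⟩ else 1) := by
    intro σ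
    constructor
    · intro h v hv
      rw [dif_pos hv]
      exact h ⟨v, hv⟩
    · intro h v
      have := h v v.2
      rwa [dif_pos v.2] at this
  have key : ∀ (B : Set (Config V)) (p : Config V → Prop) [DecidablePred p], (∀ σ, σ ∈ B ↔ p σ) →
      (∀ a ∈ Λ, IgnoresSpin (fun σ => if p σ then 1 else 0) a) →
      prob (gibbs G β γ lam) (pinned Λ τ ∩ B)
        = C * mass (F * fun σ => if p σ then 1 else 0) / partitionFunction G β γ lam := by
    intro B p _ hBp hp
    rw [prob_gibbs, ← hsum _ hp]
    congr 1
    refine Finset.sum_congr rfl fun σ _ => ?_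
    simp only [Set.mem_inter_iff, hpin, hBp]
    by_cases h : p σ <;> simp [h]
  have hw : ∀ a ∈ Λ, (w : V) ≠ a := fun a ha h => w.2 (h ▸ ha)
  have hu : ∀ a ∈ Λ, (u : V) ≠ a := fun a ha h => u.2 (h ▸ ha)
  have e1 : prob (gibbs G β γ lam) (hasSpin (w : V) 1 ∩ pinned Λ τ)
      = C * spinMass F w 1 / partitionFunction G β γ lam := by
    rw [Set.inter_comm, key (hasSpin (w : V) 1) (fun σ => σ w = 1) (fun _ => Iff.rfl) fun a ha σ x => by
      simp only [Function.update_of_ne (hw a ha)]]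
    congr 2
    exact Finset.sum_congr rfl fun σ _ => by simp
  have e2 : ∀ x, prob (gibbs G β γ lam) (pinned Λ τ ∩ hasSpin (w : V) x)
      = C * spinMass F w x / partitionFunction G β γ lam := by
    intro x
    rw [key (hasSpin (w : V) x) (fun σ => σ w = x) (fun _ => Iff.rfl) fun a ha σ y => by
      simp only [Function.update_of_ne (hw a ha)]]
    congr 2
    exact Finset.sum_congr rfl fun σ _ => by simp
  have e3 : ∀ x, prob (gibbs G β γ lam) (hasSpin (u : V) 1 ∩ (pinned Λ τ ∩ hasSpin (w : V) x))
      = C * spinMass (F * fun σ => if σ (u : V) = 1 then (1 : ℝ) else 0) (w : V) x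
        / partitionFunction G β γ lam := by
    intro x
    rw [Set.inter_comm, Set.inter_assoc,
      key (hasSpin (w : V) x ∩ hasSpin (u : V) 1) (fun σ => σ w = x ∧ σ u = 1) (fun _ => Iff.rfl)
      fun a ha σ y => by
        simp only [Function.update_of_ne (hw a ha), Function.update_of_ne (hu a ha)]]
    congr 2
    refine Finset.sum_congr rfl fun σ _ => ?_
    simp only [Pi.mul_apply, ite_and, mul_ite, mul_one, mul_zero]
  simp only [influenceMatrix, Matrix.of_apply]
  split_ifs with hdet
  · exact Or.inl rfl
  · right
    push Not at hdet
    have hm0 : marginal (gibbs G β γ lam) Λ τ w 1 ≠ 0 := fun h => hdet.1 (Or.inl h)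
    have hne : C * spinMass F w 1 ≠ 0 := by
      intro h0
      refine hm0 ?_
      rw [marginal, condProb, e1, h0, zero_div, zero_div]
    have hC' : C ≠ 0 := left_ne_zero_of_mul hne
    have hpos : 0 < spinMass F w 1 :=
      (spinMass_nonneg hFnn _ _).lt_of_ne (right_ne_zero_of_mul hne).symm
    refine ⟨div_pos hpos (spinMass_neg_one_pos hFnn (regionWeight_neg_one_pos G hγ hφ) _), ?_⟩
    unfold regionInfluence influence condProb
    simp only [e2, e3, div_div_div_cancel_right₀ hZ, mul_div_mul_left _ _ hC', ← hF]

end Gibbs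

/-! ### Spectral radius -/

section SpectralRadius

lemma matrixSpectralRadius_le {ι : Type*} [Fintype ι] [DecidableEq ι] {M : Matrix ι ι ℝ} {B : ℝ}
    (h : ∀ (t : ℝ) (x : ι → ℝ), 0 ≤ t → 0 ≤ x → x ≠ 0 →
      (∀ i, t * x i ≤ ∑ j, |M i j| * x j) → t ≤ B) :
    matrixSpectralRadius M ≤ ENNReal.ofReal B := by
  refine iSup₂_le fun μ hμ => ?_
  rw [← Matrix.spectrum_toLin', ← Module.End.hasEigenvalue_iff_mem_spectrum] at hμ
  obtain ⟨z, hz⟩ := hμ.exists_hasEigenvector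
  have hz' := hz.apply_eq_smul
  rw [← enorm_eq_nnnorm, ← ofReal_norm]
  refine ENNReal.ofReal_le_ofReal (h _ (fun i => ‖z i‖) (norm_nonneg _)
    (fun i => norm_nonneg _) (fun h0 => hz.2 ?_) fun i => ?_)
  · exact funext fun i => norm_eq_zero.1 (congrFun h0 i)
  · have hi := congrFun hz' i
    rw [Matrix.toLin'_apply, Pi.smul_apply, smul_eq_mul] at hi
    rw [← norm_mul, ← hi]
    refine (norm_sum_le _ _).trans_eq (Finset.sum_congr rfl fun j _ => ?_)
    simp [Matrix.map_apply]

lemma Lp_sum_le {ι : Type*} [Fintype ι] {p : ℝ} (hp : 1 ≤ p) (n : ℕ) (a : ℕ → ι → ℝ)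
    (ha : ∀ ℓ i, 0 ≤ a ℓ i) :
    (∑ i, (∑ ℓ ∈ Finset.range n, a ℓ i) ^ p) ^ (1 / p)
      ≤ ∑ ℓ ∈ Finset.range n, (∑ i, a ℓ i ^ p) ^ (1 / p) := by
  have hp0 : p ≠ 0 := by linarith
  induction n with
  | zero => simp [Real.zero_rpow hp0, Real.zero_rpow (inv_ne_zero hp0)]
  | succ n ih =>
    simp only [Finset.sum_range_succ]
    exact (Real.Lp_add_le_of_nonneg _ hp (fun i _ => Finset.sum_nonneg fun ℓ _ => ha ℓ i)
      fun i _ => ha n i).trans (add_le_add ih le_rfl)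

/-- A bound in `ℓ²` on `W` in terms of `m ^ s` is a bound in `ℓ^(2s)` on `W ^ (1 / s)` in terms
of `m`. -/
lemma Lp_rpow_le {ι : Type*} [Fintype ι] {s K d B : ℝ} (hs : 0 < s) (hK : 0 ≤ K) (hd : 0 ≤ d)
    (hB : 0 ≤ B) {W m : ι → ℝ} (hW : ∀ i, 0 ≤ W i) (hm : ∀ i, 0 ≤ m i)
    (h : ∑ i, W i ^ 2 ≤ B ^ 2 * ∑ i, (m i ^ s) ^ 2) :
    (∑ i, (K * (d * W i) ^ (1 / s)) ^ (2 * s)) ^ (1 / (2 * s))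
      ≤ K * (d * B) ^ (1 / s) * (∑ i, m i ^ (2 * s)) ^ (1 / (2 * s)) := by
  have hs2 : 0 < 2 * s := by linarith
  have h1 : ∀ x : ℝ, 0 ≤ x → (x ^ (1 / s)) ^ (2 * s) = x ^ 2 := fun x hx => by
    rw [← Real.rpow_mul hx, show 1 / s * (2 * s) = (2 : ℕ) by field_simp; norm_num,
      Real.rpow_natCast]
  have h2 : ∀ i, (m i ^ s) ^ 2 = m i ^ (2 * s) := fun i => by
    rw [← Real.rpow_natCast, ← Real.rpow_mul (hm i)]
    norm_num [mul_comm]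
  have hm2 : 0 ≤ ∑ i, m i ^ (2 * s) := Finset.sum_nonneg fun i _ => Real.rpow_nonneg (hm i) _
  have h3 : ∑ i, (K * (d * W i) ^ (1 / s)) ^ (2 * s)
      ≤ (K * (d * B) ^ (1 / s)) ^ (2 * s) * ∑ i, m i ^ (2 * s) := by
    simp only [h2] at h
    have hi : ∀ i, (K * (d * W i) ^ (1 / s)) ^ (2 * s) = K ^ (2 * s) * d ^ 2 * W i ^ 2 :=
      fun i => by
        have h0 : 0 ≤ d * W i := mul_nonneg hd (hW i)
        rw [Real.mul_rpow hK (Real.rpow_nonneg h0 _), h1 _ h0, mul_pow, mul_assoc]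
    have h0 : 0 ≤ d * B := mul_nonneg hd hB
    simp only [hi]
    rw [← Finset.mul_sum, Real.mul_rpow hK (Real.rpow_nonneg h0 _), h1 _ h0]
    calc _ ≤ K ^ (2 * s) * d ^ 2 * (B ^ 2 * ∑ i, m i ^ (2 * s)) :=
          mul_le_mul_of_nonneg_left h (by positivity)
      _ = _ := by ring
  have hKB : 0 ≤ K * (d * B) ^ (1 / s) := by positivity
  refine (Real.rpow_le_rpow (Finset.sum_nonneg fun i _ => ?_) h3 (by positivity)).trans_eq ?_
  · have := hW i
    positivity
  · rw [Real.mul_rpow (Real.rpow_nonneg hKB _) hm2, ← Real.rpow_mul hKB,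
      mul_one_div_cancel hs2.ne', Real.rpow_one]

lemma sum_pow_sub_two_le {q : ℝ} (hq0 : 0 ≤ q) (hq1 : q < 1) (n : ℕ) :
    ∑ ℓ ∈ Finset.range n, q ^ (ℓ - 2) ≤ 3 / (1 - q) := by
  have hq : 0 < 1 - q := by linarith
  have h1 : ∑ ℓ ∈ Finset.range n, q ^ (ℓ - 2) ≤ ∑ ℓ ∈ Finset.range (n + 2), q ^ (ℓ - 2) :=
    Finset.sum_le_sum_of_subset_of_nonneg (Finset.range_subset_range.2 (by omega))
      fun _ _ _ => pow_nonneg hq0 _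
  refine h1.trans ?_
  rw [Finset.sum_range_succ', Finset.sum_range_succ', le_div_iff₀ hq]
  have h2 := geom_sum_mul_neg q n
  have h3 := pow_nonneg hq0 n
  simp only [Nat.reduceSubDiff, zero_add, pow_zero,
    show 1 - 2 = 0 from rfl]
  nlinarith

variable {V : Type*} [Fintype V] [DecidableEq V] {G : SimpleGraph V} [DecidableRel G.Adj]
  {s ε ρ c β γ lam : ℝ} {Δ : ℕ} {Ψ : ℝ → ℝ}

/-- The bound on the spectral radius in terms of the contraction rate. -/
theorem matrixSpectralRadius_influenceMatrix_le (hε : ε ∈ Set.Ioo (0 : ℝ) 1) (hρ : 1 < ρ)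
    (hP : IsPotential s ((1 - ε) / ρ) c Δ β γ lam Ψ) (hs : 1 ≤ s) (hc : 0 ≤ c) (hβ : 0 ≤ β)
    (hγ : 0 < γ) (hlam : 0 < lam) (hΔ1 : 1 < Δ) (hΔ : G.maxDegree = Δ) {k N : ℕ} (hk : 1 ≤ k)
    (hN : 1 ≤ N) (hH : l2Norm (nonBacktrackingMatrix G k ^ N) ≤ ρ ^ N) (Λ : Finset V)
    (τ : Λ → ℤˣ) :
    matrixSpectralRadius (influenceMatrix (gibbs G β γ lam) Λ τ)
      ≤ ENNReal.ofReal ((Δ + c * Δ * Δ) * (Δ ^ (k + N) * ρ ^ 2)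
          * (3 / (1 - (1 - ε) ^ (1 / s)))) := by
  obtain ⟨hε0, hε1⟩ := hε
  have hs0 : 0 < s := by linarith
  have hs2 : 0 < 2 * s := by linarith
  have hρ0 : 0 < ρ := by linarith
  have hΔ1' : (1 : ℝ) ≤ Δ := by exact_mod_cast hΔ1.le
  have hδ : 0 ≤ (1 - ε) / ρ := div_nonneg (by linarith) hρ0.le
  obtain ⟨φ, hφ, hB, hM⟩ := influenceMatrix_eq G hβ hγ hlam Λ τ
  rw [hΔ] at hB
  refine matrixSpectralRadius_le fun t x ht hx hx0 hev => ?_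
  set M := influenceMatrix (gibbs G β γ lam) Λ τ
  set K : ℝ := Δ + c * Δ * Δ with hK
  have hK0 : 0 ≤ K := by positivity
  set δ := (1 - ε) / ρ with hδdef
  set m : V → ℝ := fun v => if h : v ∉ Λ then x ⟨v, h⟩ else 0 with hmdef
  have hm : 0 ≤ m := fun v => by
    by_cases h : v ∈ Λ
    · simp [hmdef, h]
    · simpa [hmdef, h] using hx ⟨v, h⟩
  have hmx : ∀ v : {v : V // v ∉ Λ}, m v = x v := fun v => dif_pos v.2
  have hms : 0 ≤ fun v => m v ^ s := fun v => Real.rpow_nonneg (hm v) _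
  set W : ℕ → V → ℝ := fun ℓ => walkCount G (fun v => m v ^ s) ℓ Finset.univ with hW
  have hW0 : ∀ ℓ v, 0 ≤ W ℓ v := fun ℓ v => walkCount_nonneg G hms _ _ _
  have ha0 : ∀ ℓ v, 0 ≤ K * (δ ^ (ℓ - 2) * W ℓ v) ^ (1 / s) := fun ℓ v =>
    mul_nonneg hK0 (Real.rpow_nonneg (mul_nonneg (pow_nonneg hδ _) (hW0 ℓ v)) _)
  -- Each row of the influence matrix is bounded by walk sums.
  have hrow : ∀ v, t * m v
      ≤ ∑ ℓ ∈ Finset.range (Λᶜ).card, K * (δ ^ (ℓ - 2) * W ℓ v) ^ (1 / s) := by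
    intro v
    by_cases hv : v ∈ Λ
    · rw [hmdef]
      simp only [hv, not_true_eq_false, dif_neg, not_false_eq_true, mul_zero]
      exact Finset.sum_nonneg fun ℓ _ => ha0 ℓ v
    · refine (hmx ⟨v, hv⟩ ▸ hev ⟨v, hv⟩).trans ?_
      have hvS : v ∈ Λᶜ := Finset.mem_compl.2 hv
      rcases (regionRatio_nonneg G hβ hγ hφ v).eq_or_lt with h0 | hr
      · refine (Finset.sum_eq_zero fun u _ => ?_).trans_le (Finset.sum_nonneg fun ℓ _ => ha0 ℓ v)
        rcases hM ⟨v, hv⟩ u with h | h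
        · rw [h, abs_zero, zero_mul]
        · exact absurd h.1 h0.not_lt
      · calc ∑ u, |M ⟨v, hv⟩ u| * x u
            ≤ ∑ u : {u : V // u ∉ Λ}, |regionInfluence G β γ Λᶜ φ v u| * m u := by
              refine Finset.sum_le_sum fun u _ => ?_
              rw [hmx]
              refine mul_le_mul_of_nonneg_right ?_ (hx u)
              rcases hM ⟨v, hv⟩ u with h | h
              · rw [h, abs_zero]; exact abs_nonneg _
              · rw [h.2]
          _ = ∑ u ∈ Λᶜ, |regionInfluence G β γ Λᶜ φ v u| * m u :=
              (Finset.sum_subtype Λᶜ (fun u => Finset.mem_compl)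
                (fun u => |regionInfluence G β γ Λᶜ φ v u| * m u)).symm
          _ ≤ ∑ ℓ ∈ Finset.range (Λᶜ).card, walkSum G β γ m ℓ Λᶜ φ v :=
              sum_abs_regionInfluence_le G hβ hγ hm _ Λᶜ φ v rfl hφ hvS hr
          _ ≤ _ := by
              refine Finset.sum_le_sum fun ℓ _ =>
                (hP.walkSum_root_le hs hδ hc hβ hγ hlam hΔ1 hΔ.le hm hφ hB hvS ℓ).trans ?_
              refine mul_le_mul_of_nonneg_left (Real.rpow_le_rpow
                (mul_nonneg (pow_nonneg hδ _) (walkCount_nonneg G hms _ _ _)) ?_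
                (by positivity)) hK0
              exact mul_le_mul_of_nonneg_left
                (walkCount_mono G hms ℓ (Finset.subset_univ _) v) (pow_nonneg hδ _)
  -- The `ℓ^(2s)`-norm of `m` is positive.
  have hnorm : 0 < (∑ v, m v ^ (2 * s)) ^ (1 / (2 * s)) := by
    obtain ⟨v, hv⟩ := Function.ne_iff.1 hx0
    refine Real.rpow_pos_of_pos (Finset.sum_pos' (fun v _ => Real.rpow_nonneg (hm v) _)
      ⟨v, Finset.mem_univ _, Real.rpow_pos_of_pos ?_ _⟩) _
    rw [hmx]
    exact (hx v).lt_of_ne (Ne.symm hv)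
  set q : ℝ := (1 - ε) ^ (1 / s) with hq
  have hq0 : 0 ≤ q := Real.rpow_nonneg (by linarith) _
  have hq1 : q < 1 := Real.rpow_lt_one (by linarith) (by linarith) (by positivity)
  set B : ℝ := Δ ^ (k + N) * ρ ^ 2 with hBdef
  have hB1 : 1 ≤ B := one_le_mul_of_one_le_of_one_le (one_le_pow₀ hΔ1') (one_le_pow₀ hρ.le)
  -- The growth `ρ ^ ℓ` of the number of walks cancels against `δ ^ ℓ`.
  have hterm : ∀ ℓ, (δ ^ (ℓ - 2) * (Δ ^ (k + N) * ρ ^ ℓ)) ^ (1 / s) ≤ B * q ^ (ℓ - 2) := by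
    intro ℓ
    have h1 : δ ^ (ℓ - 2) * (Δ ^ (k + N) * ρ ^ ℓ) ≤ B * (1 - ε) ^ (ℓ - 2) := by
      calc δ ^ (ℓ - 2) * (Δ ^ (k + N) * ρ ^ ℓ)
          ≤ δ ^ (ℓ - 2) * (Δ ^ (k + N) * ρ ^ (2 + (ℓ - 2))) := by
            refine mul_le_mul_of_nonneg_left (mul_le_mul_of_nonneg_left
              (pow_le_pow_right₀ hρ.le (by omega)) (by positivity)) (pow_nonneg hδ _)
        _ = B * (δ * ρ) ^ (ℓ - 2) := by rw [hBdef, pow_add, mul_pow]; ring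
        _ = _ := by rw [hδdef, div_mul_cancel₀ _ hρ0.ne']
    have hε' : 0 ≤ 1 - ε := by linarith
    refine (Real.rpow_le_rpow (mul_nonneg (pow_nonneg hδ _) (by positivity)) h1
      (by positivity)).trans ?_
    rw [Real.mul_rpow (by linarith) (pow_nonneg hε' _), hq, ← Real.rpow_natCast (1 - ε),
      ← Real.rpow_mul hε', mul_comm ((ℓ - 2 : ℕ) : ℝ), Real.rpow_mul hε', Real.rpow_natCast]
    refine mul_le_mul_of_nonneg_right ?_ (pow_nonneg hq0 _)
    calc B ^ (1 / s) ≤ B ^ (1 : ℝ) :=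
          Real.rpow_le_rpow_of_exponent_le hB1 (by rw [div_le_one hs0]; exact hs)
      _ = B := Real.rpow_one B
  refine le_of_mul_le_mul_right ?_ hnorm
  calc t * (∑ v, m v ^ (2 * s)) ^ (1 / (2 * s))
      = (∑ v, (t * m v) ^ (2 * s)) ^ (1 / (2 * s)) := by
        simp_rw [fun v => Real.mul_rpow (z := 2 * s) ht (hm v)]
        rw [← Finset.mul_sum, Real.mul_rpow (Real.rpow_nonneg ht _)
          (Finset.sum_nonneg fun v _ => Real.rpow_nonneg (hm v) _), ← Real.rpow_mul ht,
          mul_one_div_cancel hs2.ne', Real.rpow_one]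
    _ ≤ (∑ v, (∑ ℓ ∈ Finset.range (Λᶜ).card,
          K * (δ ^ (ℓ - 2) * W ℓ v) ^ (1 / s)) ^ (2 * s)) ^ (1 / (2 * s)) := by
        refine Real.rpow_le_rpow (Finset.sum_nonneg fun v _ =>
          Real.rpow_nonneg (mul_nonneg ht (hm v)) _) (Finset.sum_le_sum fun v _ =>
          Real.rpow_le_rpow (mul_nonneg ht (hm v)) (hrow v) hs2.le) (by positivity)
    _ ≤ ∑ ℓ ∈ Finset.range (Λᶜ).card,
          (∑ v, (K * (δ ^ (ℓ - 2) * W ℓ v) ^ (1 / s)) ^ (2 * s)) ^ (1 / (2 * s)) :=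
        Lp_sum_le (by linarith) _ _ ha0
    _ ≤ ∑ ℓ ∈ Finset.range (Λᶜ).card,
          K * B * q ^ (ℓ - 2) * (∑ v, m v ^ (2 * s)) ^ (1 / (2 * s)) := by
        refine Finset.sum_le_sum fun ℓ _ => (Lp_rpow_le hs0 hK0 (pow_nonneg hδ _)
          (by positivity) (hW0 ℓ) hm (sum_sq_walkCount_le hΔ.le hΔ1.le hk hN hρ.le hH hms ℓ)).trans ?_
        rw [mul_assoc K B]
        exact mul_le_mul_of_nonneg_right (mul_le_mul_of_nonneg_left (hterm ℓ) hK0) hnorm.le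
    _ ≤ _ := by
        rw [← Finset.sum_mul, ← Finset.mul_sum]
        exact mul_le_mul_of_nonneg_right (mul_le_mul_of_nonneg_left
          (sum_pow_sub_two_le hq0 hq1 _) (by positivity)) hnorm.le

end SpectralRadius

end

end TwoSpin

theorem theorem12 (Δ k N : ℕ) (hΔ : 1 < Δ) (hk : 1 ≤ k) (hN : 1 ≤ N)
    (b ρ c : ℝ) (hb : b ∈ Set.Ioo (0 : ℝ) 1) (hρ : 1 < ρ) (hc : 0 < c) :
    ∃ C : ℝ, 1 < C ∧
      ∀ (ε s β γ lam : ℝ), ε ∈ Set.Ioo (0 : ℝ) 1 → 1 ≤ s → 0 ≤ β → β ≤ γ → 0 < γ → 0 < lam →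
      (∃ Ψ : ℝ → ℝ, TwoSpin.IsPotential s ((1 - ε) / ρ) c Δ β γ lam Ψ) →
      ∀ (V : Type*) [Fintype V] [DecidableEq V] (G : SimpleGraph V) [DecidableRel G.Adj],
      G.Connected → G.maxDegree = Δ →
      TwoSpin.l2Norm (TwoSpin.nonBacktrackingMatrix G k ^ N) ^ (1 / (N : ℝ)) = ρ →
      TwoSpin.IsMarginallyBounded b (TwoSpin.gibbs G β γ lam) →
      ∀ (Λ : Finset V) (τ : Λ → ℤˣ),
        TwoSpin.matrixSpectralRadius
            (TwoSpin.influenceMatrix (TwoSpin.gibbs G β γ lam) Λ τ)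
          ≤ ENNReal.ofReal (C / (1 - (1 - ε / 4) ^ (1 / s))) := by
  have hΔ1 : (1 : ℝ) < Δ := by exact_mod_cast hΔ
  refine ⟨3 * ((Δ + c * Δ * Δ) * (Δ ^ (k + N) * ρ ^ 2)), ?_, ?_⟩
  · have h1 : 1 ≤ (Δ : ℝ) + c * Δ * Δ := by
      have : 0 < c * Δ * Δ := by positivity
      linarith
    have h2 : 1 ≤ (Δ : ℝ) ^ (k + N) * ρ ^ 2 :=
      one_le_mul_of_one_le_of_one_le (one_le_pow₀ hΔ1.le) (one_le_pow₀ hρ.le)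
    have := one_le_mul_of_one_le_of_one_le h1 h2
    linarith
  intro ε s β γ lam hε hs hβ _ hγ hlam ⟨Ψ, hP⟩ V _ _ G _ _ hG hH _ Λ τ
  have hN0 : (N : ℝ) ≠ 0 := by positivity
  have hH' : TwoSpin.l2Norm (TwoSpin.nonBacktrackingMatrix G k ^ N) ≤ ρ ^ N := by
    rw [← hH, ← Real.rpow_natCast, ← Real.rpow_mul (TwoSpin.l2Norm_nonneg _),
      one_div_mul_cancel hN0, Real.rpow_one]
  refine (TwoSpin.matrixSpectralRadius_influenceMatrix_le hε hρ hP hs hc.le hβ hγ hlam hΔ hG hk hN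
    hH' Λ τ).trans (ENNReal.ofReal_le_ofReal ?_)
  have hs0 : 0 < 1 / s := by positivity
  have h1 : (1 - ε / 4) ^ (1 / s) < 1 :=
    Real.rpow_lt_one (by linarith [hε.2]) (by linarith [hε.1]) hs0
  have h2 : (1 - ε) ^ (1 / s) ≤ (1 - ε / 4) ^ (1 / s) :=
    Real.rpow_le_rpow (by linarith [hε.2]) (by linarith [hε.1]) hs0.le
  rw [mul_div_assoc', mul_comm _ (3 : ℝ)]
  exact div_le_div_of_nonneg_left (by positivity) (by linarith) (by linarith)
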